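/- Conventions. Edges of a directed graph $E$ have a range $r(e)$ and a source $s(e)$; $e_1e_2\cdots e_n$ is a path when $s(e_i)=r(e_{i+1})$, vertices are the paths of length $0$, and $E^+$ is the set of finite paths. A vertex $v$ is regular if $r^{-1}(v)$ is finite and nonempty, and singular otherwise. A self-similar groupoid action $(G,E,\sigma)$ is a discrete groupoid $G$ whose unit space $G^0=E^0$ is the vertex set of $E$, with a left action $(g,e)\mapsto g(e)$ of $G$ on the edges along $r$ and a cocycle $(g,e)\mapsto g|_e\in G$, defined when $s(g)=r(e)$, with $s(g|_e)=s(e)$, $r(g|_e)=s(g(e))$ and $(hg)|_e=h|_{g(e)}\,g|_e$. Both extend to finite paths by $g(s(g))=r(g)$, $g|_{s(g)}=g$, $g(ep)=g(e)\,g|_e(p)$, $g|_{ep}=(g|_e)|_p$. Let $S_{(G,E)}$ be the inverse semigroup with zero of all triples $(p,g,q)$ with $p,q\in E^+$, $g\in G$, $s(p)=r(g)$, $s(q)=s(g)$, together with $0$, with $(p,g,q)^*=(q,g^{-1},p)$ and product $$(p,g,q)(p',h,q')=\begin{cases}(p\,g(t),\,g|_t h,\,q') & \text{if } p'=qt,\\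 (p,\,g\,h|_{h^{-1}(t)},\,q'\,h^{-1}(t)) & \text{if } q=p't,\\ 0&\text{otherwise.}\end{cases}$$ Let $\mathscr G_{(G,E)}$ be its tight groupoid, that is, the topological groupoid of germs of the conjugation action of $S_{(G,E)}$ on the space of tight characters of its semilattice of idempotents. The kernel $N$ is the set of isotropy elements $g\in G$ with $g(p)=p$ for all $p\in E^+$ with $r(p)=s(g)$. The tight kernel is $K=\bigcup_{n\ge 0}K_n$, where $K_n$ is the set of isotropy elements $g\in G$ such that, for every finite path $p$ of length at most $n$ with $r(p)=s(g)$, one has $g(p)=p$, and moreover $g|_p$ is a unit if $p$ has length $n$ or if $s(p)$ is singular. (If all vertices are regular this says: $g(p)=p$ and $g|_p=s(p)$ for all $p$ of length $n$ with $r(p)=s(g)$.) Both $N$ and $K$ are normal subgroupoids containing $G^0$, and $(G/N,E)$ (the faithful quotient) and $(G/K,E)$ are self-similar groupoid actions with $\bar g(e)=g(e)$ and $\bar g|_e=\overline{g|_e}$. If $E$ is a finite graph without sources (every $r^{-1}(v)$ is nonempty), the action is contracting if there is a finite set $F\subseteq G$ such that for every $g\in G$ there is $n$ with $g|_p\in F$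 for all paths $p$ with $r(p)=s(g)$ and length at least $n$; the smallest such $F$ is the nucleus $\mathcal N$. Theorem. (1) Let $(G,E,\sigma)$ be a contracting self-similar groupoid action on a finite graph without sources, with nucleus $\mathcal N$, and suppose that only the units in $\mathcal N$ act trivially on $E^+$ (that is, every element of $\mathcal N\cap N$ is a unit). Then $\mathscr G_{(G,E)}\cong\mathscr G_{(G/N,E)}$ as topological groupoids. (2) For every self-similar groupoid action $(G,E,\sigma)$ with tight kernel $K$, there is an isomorphism of topological groupoids $\mathscr G_{(G,E)}\cong\mathscr G_{(G/K,E)}$. In particular, if $K=N$, then $\mathscr G_{(G,E)}\cong\mathscr G_{(G/N,E)}$. -/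

import Mathlib

open CategoryTheory

universe u v w

namespace SelfSim

/-! ## Self-similar groupoid actions on directed graphs

The discrete groupoid is a Mathlib groupoid with object set `V`; an arrow `g : a ⟶ b` has
source `a` and range `b`, so that the product `h g` of the literature is `g ≫ h`.
A directed graph with vertex set `V` is a family `E`, where `E a c` is the set of edges
with range `a` and source `c`. -/

/-- Finite paths, as in the convention that `e p` is a path when `s(e) = r(p)`:
`Path E a c` is the set of finite paths with range `a` and source `c`. -/
inductive Path {V : Type u} (E : V → V → Type w) : V → V → Type (max u w)
  | nil (a : V) : Path E a a
  | cons {a b c : V} (e : E a b) (p : Path E b c) : Path E a c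

namespace Path

variable {V : Type u} {E : V → V → Type w}

/-- The length of a path. -/
def length : {a c : V} → Path E a c → ℕ
  | _, _, nil _ => 0
  | _, _, cons _ p => p.length + 1

/-- Concatenation of paths. -/
def append : {a b c : V} → Path E a b → Path E b c → Path E a c
  | _, _, _, nil _, q => q
  | _, _, _, cons e p, q => cons e (p.append q)

@[simp] theorem nil_append {a c : V} (q : Path E a c) : (nil a).append q = q := rfl

@[simp] theorem cons_append {a b c d : V} (e : E a b) (p : Path E b c) (q : Path E c d) :
    (cons e p).append q = cons e (p.append q) := rfl

@[simp] theorem append_nil {a b : V} (p : Path E a b) : p.append (nil b) = p := by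
  induction p with
  | nil => rfl
  | cons e p ih => simp [ih]

theorem append_assoc {a b c d : V} (p : Path E a b) (q : Path E b c) (r : Path E c d) :
    (p.append q).append r = p.append (q.append r) := by
  induction p with
  | nil => rfl
  | cons e p ih => simp [ih]

theorem append_cancel {a b c : V} (p : Path E a b) {q r : Path E b c}
    (h : p.append q = p.append r) : q = r := by
  induction p with
  | nil => exact h
  | cons e p ih => exact ih (by simpa using h)

/-- Two prefixes of the same path are comparable. -/
theorem comparable {a b b' c : V} (p : Path E a b) (p' : Path E a b') (x : Path E b c)
    (x' : Path E b' c) (h : p.append x = p'.append x') :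
    (∃ r, p' = p.append r) ∨ ∃ r, p = p'.append r := by
  induction p generalizing b' with
  | nil => exact Or.inl ⟨p', rfl⟩
  | cons e p ih =>
    cases p' with
    | nil => exact Or.inr ⟨_, rfl⟩
    | cons e' p' =>
      simp only [cons_append, cons.injEq] at h
      obtain ⟨rfl, h1, h2⟩ := h
      obtain rfl := eq_of_heq h1
      rcases ih p' x x' (eq_of_heq h2) with ⟨r, rfl⟩ | ⟨r, rfl⟩
      · exact Or.inl ⟨r, rfl⟩
      · exact Or.inr ⟨r, rfl⟩

theorem length_append {a b c : V} (p : Path E a b) (q : Path E b c) :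
    (p.append q).length = p.length + q.length := by
  induction p with
  | nil => simp [length]
  | cons e p ih => simp [length, ih]; omega

end Path

/-- A self-similar action of the groupoid `V` on the graph `E`: the action `(g, e) ↦ g(e)`
and the cocycle `(g, e) ↦ g|_e` are given together, by
`act g e = ⟨s(g(e)), g(e), g|_e⟩`, with `r(g(e)) = r(g)`, `s(g|_e) = s(e)` and
`r(g|_e) = s(g(e))`.  The two laws say that `act` is an action, `(h g)(e) = h(g(e))`, and that
the section map is a cocycle, `(h g)|_e = h|_{g(e)} g|_e`. -/
structure SSAction {V : Type u} [Groupoid.{v} V] (E : V → V → Type w) where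
  act : ∀ {a b c : V}, (a ⟶ b) → E a c → Σ d : V, E b d × (c ⟶ d)
  act_id : ∀ {a c : V} (e : E a c), act (𝟙 a) e = ⟨c, e, 𝟙 c⟩
  act_comp : ∀ {a b b' c : V} (g : a ⟶ b) (h : b ⟶ b') (e : E a c),
    act (g ≫ h) e =
      ⟨(act h (act g e).2.1).1, (act h (act g e).2.1).2.1,
        (act g e).2.2 ≫ (act h (act g e).2.1).2.2⟩

/-- A vertex is regular if it receives at least one and only finitely many edges. -/
def IsRegular {V : Type u} (E : V → V → Type w) (a : V) : Prop :=
  Nonempty (Σ c, E a c) ∧ Finite (Σ c, E a c)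

namespace SSAction

variable {V : Type u} [Groupoid.{v} V] {E : V → V → Type w} (A : SSAction E)

/-- The action and the cocycle on finite paths:
`pact g p = ⟨s(g(p)), g(p), g|_p⟩`, where `g(e p) = g(e) g|_e(p)`, `g|_{e p} = (g|_e)|_p`,
and, on paths of length zero, `g(s(g)) = r(g)`, `g|_{s(g)} = g`. -/
def pact : {a b c : V} → (a ⟶ b) → Path E a c → Σ d : V, Path E b d × (c ⟶ d)
  | _, b, _, g, .nil _ => ⟨b, .nil b, g⟩
  | _, _, _, g, .cons e p =>
    let x := A.act g e
    let y := pact x.2.2 p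
    ⟨y.1, .cons x.2.1 y.2.1, y.2.2⟩

@[simp] theorem pact_nil {a b : V} (g : a ⟶ b) :
    A.pact g (.nil a) = ⟨b, .nil b, g⟩ := rfl

theorem pact_cons {a b c d : V} (g : a ⟶ b) (e : E a c) (p : Path E c d) :
    A.pact g (.cons e p) =
      ⟨(A.pact (A.act g e).2.2 p).1, .cons (A.act g e).2.1 (A.pact (A.act g e).2.2 p).2.1,
        (A.pact (A.act g e).2.2 p).2.2⟩ := rfl

theorem pact_id {a c : V} (p : Path E a c) : A.pact (𝟙 a) p = ⟨c, p, 𝟙 c⟩ := by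
  induction p with
  | nil => rfl
  | cons e p ih => rw [pact_cons, A.act_id]; simp only; rw [ih]

theorem pact_comp {a b b' c : V} (g : a ⟶ b) (h : b ⟶ b') (p : Path E a c) :
    A.pact (g ≫ h) p =
      ⟨(A.pact h (A.pact g p).2.1).1, (A.pact h (A.pact g p).2.1).2.1,
        (A.pact g p).2.2 ≫ (A.pact h (A.pact g p).2.1).2.2⟩ := by
  induction p generalizing b b' with
  | nil => rfl
  | cons e p ih => rw [pact_cons, A.act_comp]; simp only; rw [ih]; rfl

theorem pact_append {a b c d : V} (g : a ⟶ b) (p : Path E a c) (q : Path E c d) :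
    A.pact g (p.append q) =
      ⟨(A.pact (A.pact g p).2.2 q).1, (A.pact g p).2.1.append (A.pact (A.pact g p).2.2 q).2.1,
        (A.pact (A.pact g p).2.2 q).2.2⟩ := by
  induction p generalizing b with
  | nil => rfl
  | cons e p ih => rw [Path.cons_append, pact_cons, ih]; rfl

theorem length_pact {a b c : V} (g : a ⟶ b) (p : Path E a c) :
    (A.pact g p).2.1.length = p.length := by
  induction p generalizing b with
  | nil => rfl
  | cons e p ih => rw [pact_cons]; simp [Path.length, ih]

/-! ### Elements `p k`, with `p` a path and `k` a groupoid element -/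

/-- Elements `p k` with `p` a path with range `a` and `k` a groupoid element with source `c`. -/
abbrev Bim (E : V → V → Type w) (a c : V) := Σ d : V, Path E a d × (c ⟶ d)

/-- `g (p k) = g(p) (g|_p k)`. -/
def gmul {a b c : V} (g : a ⟶ b) (x : Bim E a c) : Bim E b c :=
  ⟨(A.pact g x.2.1).1, (A.pact g x.2.1).2.1, x.2.2 ≫ (A.pact g x.2.1).2.2⟩

/-- `q (p k) = (q p) k`. -/
def pmul {a b c : V} (q : Path E a b) (x : Bim E b c) : Bim E a c :=
  ⟨x.1, q.append x.2.1, x.2.2⟩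

theorem gmul_id {a c : V} (x : Bim E a c) : A.gmul (𝟙 a) x = x := by
  obtain ⟨d, p, k⟩ := x
  simp only [gmul]; rw [pact_id]; simp

theorem gmul_comp {a b b' c : V} (g : a ⟶ b) (h : b ⟶ b') (x : Bim E a c) :
    A.gmul (g ≫ h) x = A.gmul h (A.gmul g x) := by
  obtain ⟨d, p, k⟩ := x
  simp only [gmul]; rw [pact_comp]; simp

theorem gmul_inv_gmul {a b c : V} (g : a ⟶ b) (x : Bim E a c) :
    A.gmul (Groupoid.inv g) (A.gmul g x) = x := by
  rw [← gmul_comp, Groupoid.comp_inv, gmul_id]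

theorem gmul_gmul_inv {a b c : V} (g : a ⟶ b) (x : Bim E b c) :
    A.gmul g (A.gmul (Groupoid.inv g) x) = x := by
  rw [← gmul_comp, Groupoid.inv_comp, gmul_id]

theorem gmul_pmul {a b c d : V} (g : a ⟶ b) (q : Path E a d) (x : Bim E d c) :
    A.gmul g (pmul q x) = pmul (A.pact g q).2.1 (A.gmul (A.pact g q).2.2 x) := by
  obtain ⟨d, p, k⟩ := x
  simp only [gmul, pmul]; rw [pact_append]

theorem pmul_pmul {a b c d : V} (p : Path E a b) (q : Path E b c) (x : Bim E c d) :
    pmul p (pmul q x) = pmul (p.append q) x := by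
  simp [pmul, Path.append_assoc]

theorem pmul_cancel {a b c : V} (p : Path E a b) {x y : Bim E b c}
    (h : pmul p x = pmul p y) : x = y := by
  obtain ⟨d, p, k⟩ := x
  obtain ⟨d', p', k'⟩ := y
  simp only [pmul, Sigma.mk.injEq] at h
  obtain ⟨rfl, h⟩ := h
  have h := eq_of_heq h
  simp only [Prod.mk.injEq] at h
  obtain ⟨h1, rfl⟩ := h
  rw [Path.append_cancel _ h1]

end SSAction

/-! ## Kernel, tight kernel and quotients -/

/-- A normal subgroupoid `K`, consisting of isotropy and containing all units, with
`k(e) = e` and `k|_e ∈ K` for every `k ∈ K` and every edge `e` with `r(e) = s(k)`.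
These are the subgroupoids by which a self-similar action can be divided without changing
the graph. -/
structure SSAction.Normal {V : Type u} [Groupoid.{v} V] {E : V → V → Type w} (A : SSAction E) where
  carrier : ∀ a : V, Set (a ⟶ a)
  id_mem : ∀ a, 𝟙 a ∈ carrier a
  comp_mem : ∀ {a} {g h : a ⟶ a}, g ∈ carrier a → h ∈ carrier a → g ≫ h ∈ carrier a
  inv_mem : ∀ {a} {g : a ⟶ a}, g ∈ carrier a → Groupoid.inv g ∈ carrier a
  conj_mem : ∀ {a b} {g : a ⟶ a} (h : a ⟶ b), g ∈ carrier a →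
    Groupoid.inv h ≫ g ≫ h ∈ carrier b
  act_mem : ∀ {a c} {g : a ⟶ a} (e : E a c), g ∈ carrier a →
    ∃ k ∈ carrier c, A.act g e = ⟨c, e, k⟩

namespace SSAction

variable {V : Type u} [Groupoid.{v} V] {E : V → V → Type w} (A : SSAction E)

theorem pact_inv_of_fix {a b c d : V} {g : a ⟶ b} {p : Path E a c} {q : Path E b d}
    {k : c ⟶ d} (h : A.pact g p = ⟨d, q, k⟩) :
    A.pact (Groupoid.inv g) q = ⟨c, p, Groupoid.inv k⟩ := by
  have h1 := A.gmul_inv_gmul g (⟨c, p, Groupoid.inv k⟩ : Bim E a d)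
  simp only [gmul] at h1
  rw [h] at h1
  simpa only [Groupoid.inv_comp, Category.id_comp] using! h1

theorem pact_comp_of_eq {a b b' c d d' : V} {g : a ⟶ b} {h : b ⟶ b'} {p : Path E a c}
    {q : Path E b d} {r : Path E b' d'} {k : c ⟶ d} {l : d ⟶ d'}
    (hg : A.pact g p = ⟨d, q, k⟩) (hh : A.pact h q = ⟨d', r, l⟩) :
    A.pact (g ≫ h) p = ⟨d', r, k ≫ l⟩ := by
  rw [pact_comp, hg]; simp only; rw [hh]

theorem act_eq_of_pact {a b c d c' : V} {g : a ⟶ b} {e : E a c} {p : Path E c d}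
    {e' : E b c'} {p' : Path E c' d} {k : d ⟶ d}
    (h : A.pact g (.cons e p) = ⟨d, .cons e' p', k⟩) :
    ∃ l, A.act g e = ⟨c', e', l⟩ ∧ A.pact l p = ⟨d, p', k⟩ := by
  rw [pact_cons] at h
  generalize hx : A.act g e = x at h
  obtain ⟨x1, x2, x3⟩ := x
  simp only at h
  generalize hy : A.pact x3 p = y at h
  obtain ⟨y1, y2, y3⟩ := y
  simp only [Sigma.mk.injEq] at h
  obtain ⟨rfl, h⟩ := h
  have h := eq_of_heq h
  simp only [Prod.mk.injEq, Path.cons.injEq] at h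
  obtain ⟨⟨rfl, h1, h2⟩, rfl⟩ := h
  obtain rfl := eq_of_heq h1
  obtain rfl := eq_of_heq h2
  exact ⟨x3, rfl, hy⟩

theorem pact_cons_of_act {a b c d c' d' : V} {g : a ⟶ b} {e : E a c} {e' : E b c'}
    {l : c ⟶ c'} (h : A.act g e = ⟨c', e', l⟩) {p : Path E c d} {p' : Path E c' d'}
    {k : d ⟶ d'} (h' : A.pact l p = ⟨d', p', k⟩) :
    A.pact g (.cons e p) = ⟨d', .cons e' p', k⟩ := by
  rw [pact_cons, h]; simp only; rw [h']

/-- The kernel `N` of the action on finite paths: the isotropy elements `g` with `g(p) = p` for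
every finite path `p` with range `s(g)`. -/
def kernel : A.Normal where
  carrier a := {g | ∀ (c : V) (p : Path E a c), ∃ k : c ⟶ c, A.pact g p = ⟨c, p, k⟩}
  id_mem a c p := ⟨_, A.pact_id p⟩
  comp_mem hg hh c p := by
    obtain ⟨k, hk⟩ := hg c p
    obtain ⟨l, hl⟩ := hh c p
    exact ⟨_, A.pact_comp_of_eq hk hl⟩
  inv_mem hg c p := by
    obtain ⟨k, hk⟩ := hg c p
    exact ⟨_, A.pact_inv_of_fix hk⟩
  conj_mem h hg c p := by
    generalize hx : A.pact (Groupoid.inv h) p = x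
    obtain ⟨d, q, l⟩ := x
    obtain ⟨k, hk⟩ := hg d q
    have h2 := A.pact_inv_of_fix hx
    rw [Groupoid.inv_eq_inv, Groupoid.inv_eq_inv, IsIso.inv_inv] at h2
    exact ⟨_, A.pact_comp_of_eq hx (A.pact_comp_of_eq hk h2)⟩
  act_mem {a c g} e hg := by
    obtain ⟨k, hk⟩ := hg c (.cons e (.nil c))
    obtain ⟨l, hl, h2⟩ := A.act_eq_of_pact hk
    refine ⟨l, fun d p => ?_, hl⟩
    obtain ⟨k', hk'⟩ := hg d (.cons e p)
    obtain ⟨l', hl', h'⟩ := A.act_eq_of_pact hk'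
    rw [hl] at hl'
    simp only [Sigma.mk.injEq, heq_eq_eq, Prod.mk.injEq, true_and] at hl'
    exact ⟨k', hl' ▸ h'⟩

/-- The set `K_n` of isotropy elements `g` such that, for every path `p` with range `s(g)` and
length at most `n`, one has `g(p) = p`, and moreover `g|_p` is a unit if `p` has length `n` or if
the source of `p` is singular (that is, not regular). -/
def tightLevel (n : ℕ) (a : V) : Set (a ⟶ a) :=
  {g | ∀ (c : V) (p : Path E a c), p.length ≤ n →
    ∃ k : c ⟶ c, A.pact g p = ⟨c, p, k⟩ ∧ ((p.length = n ∨ ¬ IsRegular E c) → k = 𝟙 c)}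

theorem tightLevel_succ {n : ℕ} {a : V} {g : a ⟶ a} (hg : g ∈ A.tightLevel n a) :
    g ∈ A.tightLevel (n + 1) a := by
  induction n generalizing a with
  | zero =>
    obtain ⟨k, hk, h⟩ := hg a (.nil a) (by simp [Path.length])
    have h := h (Or.inl rfl)
    subst h
    simp only [pact_nil, Sigma.mk.injEq, heq_eq_eq, Prod.mk.injEq, true_and] at hk
    subst hk
    exact fun c p _ => ⟨_, A.pact_id p, fun _ => rfl⟩
  | succ n ih =>
    intro c p hp
    cases p with
    | nil =>
      obtain ⟨k, hk, h⟩ := hg a (.nil a) (by simp [Path.length])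
      refine ⟨k, hk, fun h' => h (Or.inr ?_)⟩
      simpa [Path.length] using h'
    | @cons _ b _ e p =>
      obtain ⟨k, hk, h⟩ := hg b (.cons e (.nil b)) (by simp [Path.length])
      obtain ⟨l, hl, h2⟩ := A.act_eq_of_pact hk
      have hmem : l ∈ A.tightLevel n b := by
        intro d q hq
        obtain ⟨k', hk', h'⟩ := hg d (.cons e q) (by simpa [Path.length] using hq)
        obtain ⟨l', hl', h''⟩ := A.act_eq_of_pact hk'
        rw [hl] at hl'
        simp only [Sigma.mk.injEq, heq_eq_eq, Prod.mk.injEq, true_and] at hl'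
        subst hl'
        exact ⟨k', h'', fun h3 => h' (by simpa [Path.length] using h3)⟩
      obtain ⟨k', hk', h'⟩ := ih hmem c p (by simpa [Path.length] using hp)
      exact ⟨k', A.pact_cons_of_act hl hk', fun h3 => h' (by simpa [Path.length] using h3)⟩

theorem tightLevel_mono {m n : ℕ} (h : m ≤ n) {a : V} {g : a ⟶ a} (hg : g ∈ A.tightLevel m a) :
    g ∈ A.tightLevel n a := by
  induction h with
  | refl => exact hg
  | step _ ih => exact A.tightLevel_succ ih

/-- Regularity is invariant under the groupoid. -/
theorem isRegular_of_hom (A : SSAction E) {a b : V} (g : a ⟶ b) (h : IsRegular E a) : IsRegular E b := by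
  let f : ∀ {x y : V}, (x ⟶ y) → (Σ c, E x c) → (Σ c, E y c) :=
    fun g e => ⟨(A.act g e.2).1, (A.act g e.2).2.1⟩
  have key : ∀ e : Σ c, E b c, f g (f (Groupoid.inv g) e) = e := by
    rintro ⟨c, e⟩
    have h1 := A.act_comp (Groupoid.inv g) g e
    rw [Groupoid.inv_comp, A.act_id] at h1
    exact (congrArg (fun x : (Σ d : V, E b d × (c ⟶ d)) => (⟨x.1, x.2.1⟩ : Σ c, E b c)) h1).symm
  obtain ⟨⟨e⟩, hf⟩ := h
  exact ⟨⟨f g e⟩, Finite.of_surjective (f g) fun e => ⟨_, key e⟩⟩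

/-- The tight kernel, the union of the `K_n`. -/
def tightKernel : A.Normal where
  carrier a := {g | ∃ n, g ∈ A.tightLevel n a}
  id_mem a := ⟨0, fun c p _ => ⟨_, A.pact_id p, fun _ => rfl⟩⟩
  comp_mem := by
    rintro a g h ⟨m, hg⟩ ⟨n, hh⟩
    refine ⟨max m n, fun c p hp => ?_⟩
    obtain ⟨k, hk, h1⟩ := A.tightLevel_mono (le_max_left m n) hg c p hp
    obtain ⟨l, hl, h2⟩ := A.tightLevel_mono (le_max_right m n) hh c p hp
    exact ⟨_, A.pact_comp_of_eq hk hl, fun h => by simp [h1 h, h2 h]⟩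
  inv_mem := by
    rintro a g ⟨m, hg⟩
    refine ⟨m, fun c p hp => ?_⟩
    obtain ⟨k, hk, h1⟩ := hg c p hp
    exact ⟨_, A.pact_inv_of_fix hk, fun h => by simp [h1 h, Groupoid.inv_eq_inv]⟩
  conj_mem := by
    rintro a b g h ⟨m, hg⟩
    refine ⟨m, fun c p hp => ?_⟩
    have hlen := A.length_pact (Groupoid.inv h) p
    generalize hx : A.pact (Groupoid.inv h) p = x at hlen
    obtain ⟨d, q, l⟩ := x
    simp only at hlen
    obtain ⟨k, hk, h1⟩ := hg d q (hlen ▸ hp)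
    have h2 := A.pact_inv_of_fix hx
    rw [Groupoid.inv_eq_inv, Groupoid.inv_eq_inv, IsIso.inv_inv] at h2
    refine ⟨_, A.pact_comp_of_eq hx (A.pact_comp_of_eq hk h2), fun h => ?_⟩
    rw [h1 (h.imp (fun h => hlen.trans h) fun h h' => h (A.isRegular_of_hom (inv l) h'))]
    simp [Groupoid.inv_eq_inv]
  act_mem := by
    rintro a c g e ⟨m, hg⟩
    have hg := A.tightLevel_succ hg
    obtain ⟨k, hk, h⟩ := hg c (.cons e (.nil c)) (by simp [Path.length])
    obtain ⟨l, hl, h2⟩ := A.act_eq_of_pact hk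
    refine ⟨l, ⟨m, fun d q hq => ?_⟩, hl⟩
    obtain ⟨k', hk', h'⟩ := hg d (.cons e q) (by simpa [Path.length] using hq)
    obtain ⟨l', hl', h''⟩ := A.act_eq_of_pact hk'
    rw [hl] at hl'
    simp only [Sigma.mk.injEq, heq_eq_eq, Prod.mk.injEq, true_and] at hl'
    subst hl'
    exact ⟨k', h'', fun h3 => h' (by simpa [Path.length] using h3)⟩

/-- Arrows acting on all paths of length `n` with trivial sections, at regular vertices, together
with all units. -/
def fixLevel (n : ℕ) (a : V) : Set (a ⟶ a) :=
  {g | g = 𝟙 a ∨ IsRegular E a ∧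
    ∀ (c : V) (p : Path E a c), p.length = n → A.pact g p = ⟨c, p, 𝟙 c⟩}

/-- As soon as the union of the sets `fixLevel n` is invariant in the sense needed for passing to
the quotient (for each `k` in it and each edge `e`, `k(e) = e` and `k|_e` is again in it), it is
the tight kernel. -/
theorem tightKernel_eq_of_invariant
    (H : ∀ (a c : V) (g : a ⟶ a) (e : E a c), (∃ n, g ∈ A.fixLevel n a) →
      ∃ k : c ⟶ c, (∃ n, k ∈ A.fixLevel n c) ∧ A.act g e = ⟨c, e, k⟩) (a : V) :
    A.tightKernel.carrier a = {g | ∃ n, g ∈ A.fixLevel n a} := by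
  have key : ∀ (n : ℕ) (a : V) (g : a ⟶ a), g ∈ A.fixLevel n a → g ∈ A.tightLevel n a := by
    intro n
    induction n with
    | zero =>
      rintro a g hg c p hp
      have hg : g = 𝟙 a := by
        rcases hg with rfl | ⟨_, hg⟩
        · rfl
        · simpa using hg a (.nil a) rfl
      subst hg
      exact ⟨_, A.pact_id p, fun _ => rfl⟩
    | succ n ih =>
      rintro a g hg c p hp
      rcases hg with rfl | ⟨hr, hg⟩
      · exact ⟨_, A.pact_id p, fun _ => rfl⟩
      cases p with
      | nil => exact ⟨g, rfl, fun h => by simp [Path.length, hr] at h⟩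
      | @cons _ b _ e p =>
        obtain ⟨k, hk, he⟩ := H a b g e ⟨n + 1, Or.inr ⟨hr, hg⟩⟩
        have hk' : k ∈ A.fixLevel n b := by
          obtain ⟨m, rfl | ⟨hb, -⟩⟩ := hk
          · exact Or.inl rfl
          · refine Or.inr ⟨hb, fun d q hq => ?_⟩
            obtain ⟨l, hl, h2⟩ := A.act_eq_of_pact (hg d (.cons e q) (by simp [Path.length, hq]))
            rw [he] at hl
            simp only [Sigma.mk.injEq, heq_eq_eq, Prod.mk.injEq, true_and] at hl
            exact hl ▸ h2
        obtain ⟨l, hl, h'⟩ := ih b k hk' c p (by simpa [Path.length] using hp)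
        exact ⟨l, A.pact_cons_of_act he hl, fun h => h' (by simpa [Path.length] using h)⟩
  ext g
  refine ⟨?_, fun ⟨n, hn⟩ => ⟨n, key n a g hn⟩⟩
  rintro ⟨n, hg⟩
  by_cases hr : IsRegular E a
  · refine ⟨n, Or.inr ⟨hr, fun c p hp => ?_⟩⟩
    obtain ⟨k, hk, h⟩ := hg c p hp.le
    rw [hk, h (Or.inl hp)]
  · obtain ⟨k, hk, h⟩ := hg a (.nil a) (by simp [Path.length])
    refine ⟨n, Or.inl ?_⟩
    rw [← h (Or.inr hr)]
    simpa using hk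

/-- If all vertices are regular, the tight kernel consists of the isotropy elements `g` for which
there is an `n` such that `g(p) = p` and `g|_p = s(p)` for all paths `p` of length `n` with range
`s(g)`. -/
theorem tightKernel_of_regular (hr : ∀ a, IsRegular E a) (a : V) :
    A.tightKernel.carrier a = {g | ∃ n, ∀ (c : V) (p : Path E a c), p.length = n →
      A.pact g p = ⟨c, p, 𝟙 c⟩} := by
  have ext : ∀ (n : ℕ) (a : V), ∃ (c : V) (p : Path E a c), p.length = n := by
    intro n
    induction n with
    | zero => exact fun a => ⟨a, .nil a, rfl⟩
    | succ n ih =>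
      intro a
      obtain ⟨⟨⟨b, e⟩⟩, -⟩ := hr a
      obtain ⟨c, p, hp⟩ := ih b
      exact ⟨c, .cons e p, by simp [Path.length, hp]⟩
  have step : ∀ (n : ℕ) {a c : V} (g : a ⟶ a) (e : E a c),
      (∀ (c : V) (p : Path E a c), p.length = n + 1 → A.pact g p = ⟨c, p, 𝟙 c⟩) →
      ∃ k : c ⟶ c, A.act g e = ⟨c, e, k⟩ ∧
        ∀ (d : V) (p : Path E c d), p.length = n → A.pact k p = ⟨d, p, 𝟙 d⟩ := by
    intro n a c g e hg
    obtain ⟨d, p, hp⟩ := ext n c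
    obtain ⟨k, hk, -⟩ := A.act_eq_of_pact (hg d (.cons e p) (by simp [Path.length, hp]))
    refine ⟨k, hk, fun d' q hq => ?_⟩
    obtain ⟨l, hl, h2⟩ := A.act_eq_of_pact (hg d' (.cons e q) (by simp [Path.length, hq]))
    rw [hk] at hl
    simp only [Sigma.mk.injEq, heq_eq_eq, Prod.mk.injEq, true_and] at hl
    exact hl ▸ h2
  have fix : ∀ (a : V) (g : a ⟶ a), (∃ n, g ∈ A.fixLevel n a) ↔
      ∃ n, ∀ (c : V) (p : Path E a c), p.length = n → A.pact g p = ⟨c, p, 𝟙 c⟩ := by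
    intro a g
    constructor
    · rintro ⟨n, rfl | ⟨-, hn⟩⟩
      · exact ⟨0, fun c p _ => A.pact_id p⟩
      · exact ⟨n, hn⟩
    · rintro ⟨n, hn⟩
      exact ⟨n, Or.inr ⟨hr a, hn⟩⟩
  rw [A.tightKernel_eq_of_invariant]
  · exact Set.ext (fix a)
  · intro a c g e hg
    obtain ⟨n, hn⟩ := (fix a g).1 hg
    cases n with
    | zero =>
      have h := hn a (.nil a) rfl
      simp only [pact_nil, Sigma.mk.injEq, heq_eq_eq, Prod.mk.injEq, true_and] at h
      subst h
      exact ⟨𝟙 c, ⟨0, Or.inl rfl⟩, A.act_id e⟩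
    | succ n =>
      obtain ⟨k, hk, h⟩ := step n g e hn
      exact ⟨k, (fix c k).2 ⟨n, h⟩, hk⟩

/-! ### Contracting actions -/

/-- A finite set of arrows that contains, for every `g`, all sections of `g` at sufficiently long
paths. -/
def IsCore (F : Set (Σ a b : V, a ⟶ b)) : Prop :=
  F.Finite ∧ ∀ (a b : V) (g : a ⟶ b), ∃ n : ℕ, ∀ (c : V) (p : Path E a c), n ≤ p.length →
    (⟨c, (A.pact g p).1, (A.pact g p).2.2⟩ : Σ a b : V, a ⟶ b) ∈ F

/-- A contracting self-similar action (on a finite graph without sources). -/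
structure IsContracting : Prop where
  finite_vertices : Finite V
  finite_edges : Finite (Σ a c : V, E a c)
  no_sources : ∀ a : V, Nonempty (Σ c, E a c)
  exists_core : ∃ F, A.IsCore F

/-- The nucleus of a contracting action. -/
def nucleus : Set (Σ a b : V, a ⟶ b) := ⋂₀ {F | A.IsCore F}

/-- For a contracting action the nucleus is the smallest core. -/
theorem nucleus_isLeast (h : A.IsContracting) : IsLeast {F | A.IsCore F} A.nucleus := by
  have inter : ∀ F F', A.IsCore F → A.IsCore F' → A.IsCore (F ∩ F') := by
    rintro F F' ⟨hF, h1⟩ ⟨-, h2⟩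
    refine ⟨hF.inter_of_left F', fun a b g => ?_⟩
    obtain ⟨m, hm⟩ := h1 a b g
    obtain ⟨n, hn⟩ := h2 a b g
    exact ⟨max m n, fun c p hp =>
      ⟨hm c p (le_trans (le_max_left _ _) hp), hn c p (le_trans (le_max_right _ _) hp)⟩⟩
  obtain ⟨F, hF, hmin⟩ := WellFounded.has_min (measure (Set.ncard (α := Σ a b : V, a ⟶ b))).wf
    {F | A.IsCore F} h.exists_core
  have hle : ∀ F', A.IsCore F' → F ⊆ F' := by
    intro F' hF'
    have h1 := hmin _ (inter F F' hF hF')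
    have h2 := Set.eq_of_subset_of_ncard_le Set.inter_subset_left
      (not_lt.1 h1) hF.1
    exact Set.inter_eq_left.1 h2
  have : A.nucleus = F := Set.Subset.antisymm (Set.sInter_subset_of_mem hF)
    (Set.subset_sInter hle)
  exact this ▸ ⟨hF, fun F' hF' => hle F' hF'⟩

namespace Normal

variable {A} (K : A.Normal)

/-- Two arrows are identified in `G/K` if they differ by an element of `K`. -/
def rel : HomRel V := fun a _ g h => ∃ k ∈ K.carrier a, h = k ≫ g

instance : Congruence K.rel where
  comp_left := by
    rintro a b c f g _ ⟨k, hk, rfl⟩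
    refine ⟨f ≫ k ≫ Groupoid.inv f, ?_, by simp [Groupoid.inv_eq_inv]⟩
    simpa [Groupoid.inv_eq_inv] using K.conj_mem (Groupoid.inv f) hk
  comp_right := by
    rintro a b c f _ g ⟨k, hk, rfl⟩
    exact ⟨k, hk, by simp⟩
  equivalence :=
    { refl := fun g => ⟨_, K.id_mem _, by simp⟩
      symm := by
        rintro g _ ⟨k, hk, rfl⟩
        exact ⟨_, K.inv_mem hk, by simp⟩
      trans := by
        rintro g _ _ ⟨k, hk, rfl⟩ ⟨l, hl, rfl⟩
        exact ⟨_, K.comp_mem hl hk, by simp⟩ }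

/-- The quotient groupoid `G/K`, with the same objects as `G`. -/
abbrev Quo := CategoryTheory.Quotient K.rel

/-- The graph `E` on the objects of `G/K`. -/
abbrev graph : K.Quo → K.Quo → Type w := fun a c => E a.as c.as

/-- The quotient map on arrows. -/
abbrev cls {a b : V} (g : a ⟶ b) :
    (⟨a⟩ : K.Quo) ⟶ ⟨b⟩ := (CategoryTheory.Quotient.functor K.rel).map g

/-- Reduce the groupoid part of a triple modulo `K`. -/
def red {b c : V} (x : Σ d : V, E b d × (c ⟶ d)) :
    Σ d : K.Quo, K.graph ⟨b⟩ d × ((⟨c⟩ : K.Quo) ⟶ d) :=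
  ⟨⟨x.1⟩, x.2.1, K.cls x.2.2⟩

theorem red_act_eq {a b c : V} {g h : a ⟶ b} (H : K.rel g h) (e : E a c) :
    K.red (A.act g e) = K.red (A.act h e) := by
  obtain ⟨k, hk, rfl⟩ := H
  obtain ⟨l, hl, h2⟩ := K.act_mem e hk
  rw [A.act_comp, h2]
  simp only [red]
  have H : K.cls (A.act g e).2.2 = K.cls (l ≫ (A.act g e).2.2) :=
    CategoryTheory.Quotient.sound K.rel ⟨l, hl, rfl⟩
  rw [H]

/-- The self-similar action `(G/K, E)`: `(g K)(e) = g(e)` and `(g K)|_e = (g|_e) K`. -/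
def quotient : SSAction K.graph where
  act {a b c} g e :=
    Quot.liftOn g (fun g' : a.as ⟶ b.as => K.red (A.act g' e)) fun g₁ g₂ H =>
      K.red_act_eq ((HomRel.compClosure_iff_self K.rel g₁ g₂).1 H) e
  act_id {a c} e := by
    change K.red (A.act (𝟙 a.as) e) = _
    rw [A.act_id]; rfl
  act_comp {a b b' c} g h e := by
    induction g using Quot.ind with | _ g
    induction h using Quot.ind with | _ h
    change K.red (A.act (g ≫ h) e) = _
    rw [A.act_comp]; rfl

end Normal

end SSAction

/-! ## Inverse semigroups with zero and their tight groupoids -/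

/-- Inverse semigroups with zero: the involution is written as an inverse. -/
class InverseSemigroupWithZero (S : Type u) extends SemigroupWithZero S, Inv S where
  mul_inv_mul : ∀ s : S, s * s⁻¹ * s = s
  inv_mul_inv : ∀ s : S, s⁻¹ * s * s⁻¹ = s⁻¹
  idem_comm : ∀ e f : S, e * e = e → f * f = f → e * f = f * e

section InverseSemigroup

variable (S : Type u) [InverseSemigroupWithZero S]

/-- The idempotents of `S`. -/
def Idem := {e : S // e * e = e}

variable {S}

open InverseSemigroupWithZero

theorem inv_unique {s t : S} (h1 : s * t * s = s) (h2 : t * s * t = t) : t = s⁻¹ := by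
  have a1 : (t * s) * (t * s) = t * s := by rw [← mul_assoc, h2]
  have a2 : (s⁻¹ * s) * (s⁻¹ * s) = s⁻¹ * s := by rw [← mul_assoc, inv_mul_inv]
  have a3 : (s * t) * (s * t) = s * t := by rw [← mul_assoc, h1]
  have a4 : (s * s⁻¹) * (s * s⁻¹) = s * s⁻¹ := by rw [← mul_assoc, mul_inv_mul]
  calc t = t * s * t := h2.symm
    _ = t * (s * s⁻¹ * s) * t := by rw [mul_inv_mul]
    _ = t * ((s * s⁻¹) * (s * t)) := by simp only [mul_assoc]
    _ = t * ((s * t) * (s * s⁻¹)) := by rw [idem_comm _ _ a4 a3]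
    _ = (t * s * t) * s * s⁻¹ := by simp only [mul_assoc]
    _ = t * s * s⁻¹ := by rw [h2]
    _ = (t * s) * (s⁻¹ * s) * s⁻¹ := by
      rw [mul_assoc (t * s), inv_mul_inv]
    _ = (s⁻¹ * s) * (t * s) * s⁻¹ := by rw [idem_comm _ _ a1 a2]
    _ = s⁻¹ * (s * t * s) * s⁻¹ := by simp only [mul_assoc]
    _ = s⁻¹ := by rw [h1, inv_mul_inv]

theorem inv_inv' (s : S) : s⁻¹⁻¹ = s := (inv_unique (inv_mul_inv s) (mul_inv_mul s)).symm

theorem idem_inv_mul (s : S) : (s⁻¹ * s) * (s⁻¹ * s) = s⁻¹ * s := by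
  rw [← mul_assoc, inv_mul_inv]

theorem idem_mul_inv (s : S) : (s * s⁻¹) * (s * s⁻¹) = s * s⁻¹ := by
  rw [← mul_assoc, mul_inv_mul]

theorem idem_mul {e f : S} (he : e * e = e) (hf : f * f = f) : (e * f) * (e * f) = e * f := by
  rw [mul_assoc, ← mul_assoc f, idem_comm f e hf he, mul_assoc e f, hf, ← mul_assoc, he]

theorem mul_inv_rev' (s t : S) : (s * t)⁻¹ = t⁻¹ * s⁻¹ := by
  have h := idem_comm _ _ (idem_inv_mul s) (idem_mul_inv t)
  refine (inv_unique ?_ ?_).symm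
  · calc s * t * (t⁻¹ * s⁻¹) * (s * t) = s * ((t * t⁻¹) * (s⁻¹ * s)) * t := by
          simp only [mul_assoc]
      _ = (s * s⁻¹ * s) * (t * t⁻¹ * t) := by rw [← h]; simp only [mul_assoc]
      _ = s * t := by rw [mul_inv_mul, mul_inv_mul]
  · calc t⁻¹ * s⁻¹ * (s * t) * (t⁻¹ * s⁻¹) = t⁻¹ * ((s⁻¹ * s) * (t * t⁻¹)) * s⁻¹ := by
          simp only [mul_assoc]
      _ = (t⁻¹ * t * t⁻¹) * (s⁻¹ * s * s⁻¹) := by rw [h]; simp only [mul_assoc]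
      _ = t⁻¹ * s⁻¹ := by rw [inv_mul_inv, inv_mul_inv]

theorem idem_conj (s : S) {e : S} (he : e * e = e) :
    (s⁻¹ * e * s) * (s⁻¹ * e * s) = s⁻¹ * e * s := by
  calc (s⁻¹ * e * s) * (s⁻¹ * e * s) = s⁻¹ * (e * (s * s⁻¹)) * (e * s) := by
        simp only [mul_assoc]
    _ = (s⁻¹ * s * s⁻¹) * (e * e) * s := by
        rw [idem_comm e _ he (idem_mul_inv s)]; simp only [mul_assoc]
    _ = s⁻¹ * e * s := by rw [inv_mul_inv, he]

namespace Idem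

instance : Mul (Idem S) := ⟨fun e f => ⟨e.1 * f.1, idem_mul e.2 f.2⟩⟩

instance : Zero (Idem S) := ⟨⟨0, mul_zero 0⟩⟩

/-- The natural order of idempotents. -/
instance : LE (Idem S) := ⟨fun e f => e * f = e⟩

/-- The idempotent `s⁻¹ s`. -/
def dom (s : S) : Idem S := ⟨s⁻¹ * s, idem_inv_mul s⟩

/-- The idempotent `s⁻¹ e s`. -/
def conj (s : S) (e : Idem S) : Idem S := ⟨s⁻¹ * e.1 * s, idem_conj s e.2⟩

@[ext] theorem ext {e f : Idem S} (h : e.1 = f.1) : e = f := Subtype.ext h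

theorem val_mul (e f : Idem S) : (e * f).1 = e.1 * f.1 := rfl

theorem conj_conj (s t : S) (e : Idem S) : conj t (conj s e) = conj (s * t) e := by
  ext; simp only [conj, mul_inv_rev', mul_assoc]

theorem conj_dom (s t : S) : conj t (dom s) = dom (s * t) := by
  ext; simp only [conj, dom, mul_inv_rev', mul_assoc]

theorem conj_idem (e f : Idem S) : conj e.1 f = e * f := by
  ext
  have he : e.1⁻¹ = e.1 := (inv_unique (by rw [e.2, e.2]) (by rw [e.2, e.2])).symm
  simp only [conj, he, val_mul]
  rw [mul_assoc, idem_comm f.1 e.1 f.2 e.2, ← mul_assoc, e.2]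

theorem dom_idem (e : Idem S) : dom e.1 = e := by
  ext
  have he : e.1⁻¹ = e.1 := (inv_unique (by rw [e.2, e.2]) (by rw [e.2, e.2])).symm
  simp only [dom, he, e.2]

end Idem

/-- Characters of the semilattice of idempotents: nonzero, zero-preserving semigroup
homomorphisms to `{0, 1}`. -/
structure IsCharacter (χ : Idem S → Bool) : Prop where
  nonzero : ∃ e, χ e = true
  map_zero : χ 0 = false
  map_mul : ∀ e f, χ (e * f) = (χ e && χ f)

/-- Tight characters: `χ(e) = χ(e₁) ∨ ⋯ ∨ χ(eₙ)` whenever `e₁, …, eₙ ≤ e` cover `e`. -/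
def IsTight (χ : Idem S → Bool) : Prop :=
  ∀ (e : Idem S) (F : Finset (Idem S)), (∀ f ∈ F, f ≤ e) →
    (∀ f : Idem S, f ≠ 0 → f ≤ e → ∃ f' ∈ F, f * f' ≠ 0) →
    (χ e = true ↔ ∃ f ∈ F, χ f = true)

variable (S) in
/-- The space of tight characters, with the topology of pointwise convergence. It is the object
space of the tight groupoid of `S`. -/
def TightSpectrum := {χ : Idem S → Bool // IsCharacter χ ∧ IsTight χ}

namespace TightSpectrum

instance : TopologicalSpace (TightSpectrum S) :=
  inferInstanceAs (TopologicalSpace {χ : Idem S → Bool // IsCharacter χ ∧ IsTight χ})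

/-- In the conjugation action of `S` on characters, `χ` is in the domain of `s`, that is
`χ(s⁻¹ s) = 1`, and `s` takes it to `ψ`, that is `ψ(e) = χ(s⁻¹ e s)` for all `e`. -/
def Moves (s : S) (χ ψ : TightSpectrum S) : Prop :=
  χ.1 (Idem.dom s) = true ∧ ∀ e, ψ.1 e = χ.1 (Idem.conj s e)

theorem Moves.mul {s t : S} {χ ψ ω : TightSpectrum S} (ht : Moves t χ ψ) (hs : Moves s ψ ω) :
    Moves (s * t) χ ω := by
  refine ⟨?_, fun e => ?_⟩
  · rw [← Idem.conj_dom, ← ht.2]; exact hs.1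
  · rw [hs.2, ht.2, Idem.conj_conj]

theorem moves_idem (χ : TightSpectrum S) {e : Idem S} (he : χ.1 e = true) : Moves e.1 χ χ := by
  refine ⟨by rwa [Idem.dom_idem], fun f => ?_⟩
  rw [Idem.conj_idem, χ.2.1.map_mul, he, Bool.true_and]

theorem Moves.inv {s : S} {χ ψ : TightSpectrum S} (h : Moves s χ ψ) : Moves s⁻¹ ψ χ := by
  have h1 := h.1
  refine ⟨?_, fun e => ?_⟩
  · rw [h.2]
    convert h1 using 2
    ext
    simp only [Idem.conj, Idem.dom, inv_inv']
    rw [← mul_assoc, inv_mul_inv]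
  · rw [h.2, Idem.conj_conj]
    change _ = χ.1 (Idem.conj (Idem.dom s).1 e)
    rw [Idem.conj_idem, χ.2.1.map_mul, h1, Bool.true_and]

/-- Two elements have the same germ at `χ` if they agree after multiplication by an idempotent `e`
with `χ(e) = 1`. -/
def germSetoid (χ ψ : TightSpectrum S) : Setoid {s : S // Moves s χ ψ} where
  r s t := ∃ e : Idem S, χ.1 e = true ∧ s.1 * e.1 = t.1 * e.1
  iseqv :=
    { refl := fun s => ⟨Idem.dom s.1, s.2.1, rfl⟩
      symm := fun ⟨e, he, h⟩ => ⟨e, he, h.symm⟩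
      trans := by
        rintro s t r ⟨e, he, h⟩ ⟨f, hf, h'⟩
        refine ⟨e * f, by rw [χ.2.1.map_mul, he, hf]; rfl, ?_⟩
        rw [Idem.val_mul, ← mul_assoc, h, mul_assoc, idem_comm e.1 f.1 e.2 f.2, ← mul_assoc, h',
          mul_assoc] }

/-- The germs `[s, χ]` with `s χ = ψ`. -/
def Germ (χ ψ : TightSpectrum S) := Quotient (germSetoid χ ψ)

/-- The germ `[s, χ]`, as an arrow from `χ` to `ψ = s χ`. -/
def Germ.mk {χ ψ : TightSpectrum S} (s : S) (h : Moves s χ ψ) : Germ χ ψ :=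
  Quotient.mk _ ⟨s, h⟩

theorem Germ.mk_eq_mk {χ ψ : TightSpectrum S} {s t : S} {hs : Moves s χ ψ} {ht : Moves t χ ψ} :
    Germ.mk s hs = Germ.mk t ht ↔ ∃ e : Idem S, χ.1 e = true ∧ s * e.1 = t * e.1 :=
  Quotient.eq (r := germSetoid χ ψ)

/-- The unit at `χ`, the germ of any idempotent `e` with `χ(e) = 1`. -/
noncomputable def Germ.unit (χ : TightSpectrum S) : Germ χ χ :=
  Germ.mk χ.2.1.nonzero.choose.1 (moves_idem χ χ.2.1.nonzero.choose_spec)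

theorem Germ.unit_eq (χ : TightSpectrum S) {e : Idem S} (he : χ.1 e = true) :
    Germ.unit χ = Germ.mk e.1 (moves_idem χ he) := by
  refine Germ.mk_eq_mk.2 ⟨χ.2.1.nonzero.choose * e, ?_, ?_⟩
  · rw [χ.2.1.map_mul, χ.2.1.nonzero.choose_spec, he]; rfl
  · have h := χ.2.1.nonzero.choose.2
    rw [Idem.val_mul, ← mul_assoc, h, idem_comm _ _ h e.2, ← mul_assoc, e.2]

/-- The product `[s, t χ] [t, χ] = [s t, χ]`. -/
def Germ.comp {χ ψ ω : TightSpectrum S} (g : Germ χ ψ) (h : Germ ψ ω) : Germ χ ω :=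
  Quotient.liftOn₂ g h (fun t s => Germ.mk (s.1 * t.1) (t.2.mul s.2)) (by
    rintro ⟨t, ht⟩ ⟨s, hs⟩ ⟨t', ht'⟩ ⟨s', hs'⟩ ⟨e, he, h⟩ ⟨f, hf, h'⟩
    refine Germ.mk_eq_mk.2 ⟨Idem.conj t f * e, ?_, ?_⟩
    · rw [χ.2.1.map_mul, ← ht.2, hf, he]; rfl
    · simp only at h h'
      have key : t * (t⁻¹ * f.1 * t) = f.1 * t := by
        rw [← mul_assoc, ← mul_assoc, idem_comm (t * t⁻¹) f.1 (idem_mul_inv t) f.2, mul_assoc,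
          mul_inv_mul]
      calc s * t * (t⁻¹ * f.1 * t * e.1) = s * (t * (t⁻¹ * f.1 * t)) * e.1 := by
            simp only [mul_assoc]
        _ = (s * f.1) * t * e.1 := by rw [key]; simp only [mul_assoc]
        _ = s' * (t * (t⁻¹ * f.1 * t)) * e.1 := by rw [h', key]; simp only [mul_assoc]
        _ = s' * t * ((t⁻¹ * f.1 * t) * e.1) := by simp only [mul_assoc]
        _ = s' * (t * e.1) * (t⁻¹ * f.1 * t) := by
            rw [idem_comm _ _ (idem_conj t f.2) e.2]; simp only [mul_assoc]
        _ = s' * t' * (e.1 * (t⁻¹ * f.1 * t)) := by rw [h]; simp only [mul_assoc]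
        _ = s' * t' * (t⁻¹ * f.1 * t * e.1) := by
            rw [idem_comm _ _ (idem_conj t f.2) e.2])

/-- The inverse `[s, χ]⁻¹ = [s⁻¹, s χ]`. -/
def Germ.inv {χ ψ : TightSpectrum S} (g : Germ χ ψ) : Germ ψ χ :=
  Quotient.liftOn g (fun s => Germ.mk s.1⁻¹ s.2.inv) (by
    rintro ⟨s, hs⟩ ⟨t, ht⟩ ⟨e, he, h⟩
    refine Germ.mk_eq_mk.2 ⟨Idem.conj s⁻¹ e * Idem.conj t⁻¹ e, ?_, ?_⟩
    · rw [ψ.2.1.map_mul, ← hs.inv.2, ← ht.inv.2, he]; rfl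
    · simp only at h
      have he' : e.1⁻¹ = e.1 := (inv_unique (by rw [e.2, e.2]) (by rw [e.2, e.2])).symm
      have h2 : e.1 * s⁻¹ = e.1 * t⁻¹ := by
        have := congrArg (·⁻¹) h
        simpa only [mul_inv_rev', he'] using this
      have key : ∀ r : S, r⁻¹ * (r⁻¹⁻¹ * e.1 * r⁻¹) = e.1 * r⁻¹ := by
        intro r
        rw [inv_inv', ← mul_assoc, ← mul_assoc, idem_comm _ e.1 (idem_inv_mul r) e.2, mul_assoc,
          inv_mul_inv]
      have hc := idem_comm _ _ (idem_conj s⁻¹ e.2) (idem_conj t⁻¹ e.2)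
      have ee : s * e.1 * s⁻¹ = t * e.1 * t⁻¹ := by
        calc s * e.1 * s⁻¹ = (s * e.1) * (e.1 * s⁻¹) := by
              rw [mul_assoc, mul_assoc, ← mul_assoc e.1, e.2]
          _ = (t * e.1) * (e.1 * t⁻¹) := by rw [h, h2]
          _ = t * e.1 * t⁻¹ := by rw [mul_assoc, mul_assoc, ← mul_assoc e.1, e.2]
      have e1 : (Idem.conj s⁻¹ e).1 = (Idem.conj t⁻¹ e).1 := by
        simpa only [Idem.conj, inv_inv'] using ee
      have e2 : Idem.conj s⁻¹ e = Idem.conj t⁻¹ e := Idem.ext e1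
      have e3 : s⁻¹ * (Idem.conj s⁻¹ e).1 = t⁻¹ * (Idem.conj t⁻¹ e).1 := by
        change s⁻¹ * (s⁻¹⁻¹ * e.1 * s⁻¹) = t⁻¹ * (t⁻¹⁻¹ * e.1 * t⁻¹)
        rw [key, key, h2]
      rw [Idem.val_mul, ← mul_assoc, e3, ← mul_assoc, e1])

/-- The tight groupoid of `S`: the transformation groupoid of the conjugation action of `S` on the
space of tight characters.  The arrows from `χ` to `ψ` are the germs `[s, χ]` with `s χ = ψ`;
the product `[s, t χ] [t, χ]` is `[t, χ] ≫ [s, t χ]`. -/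
noncomputable instance groupoid : Groupoid (TightSpectrum S) where
  Hom := Germ
  id := Germ.unit
  comp := Germ.comp
  inv := Germ.inv
  id_comp := by
    rintro χ ψ ⟨s, hs⟩
    rw [Germ.unit_eq χ hs.1]
    refine Germ.mk_eq_mk.2 ⟨Idem.dom s, hs.1, ?_⟩
    simp only [Idem.dom]
    rw [mul_assoc, idem_inv_mul]
  comp_id := by
    rintro χ ψ ⟨s, hs⟩
    rw [Germ.unit_eq ψ hs.inv.1]
    refine Germ.mk_eq_mk.2 ⟨Idem.dom s, hs.1, ?_⟩
    simp only [Idem.dom, inv_inv']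
    rw [mul_inv_mul]
  assoc := by
    rintro χ ψ ω ξ ⟨s, hs⟩ ⟨t, ht⟩ ⟨r, hr⟩
    exact Germ.mk_eq_mk.2 ⟨Idem.dom s, hs.1, by simp only [mul_assoc]⟩
  inv_comp := by
    rintro χ ψ ⟨s, hs⟩
    rw [Germ.unit_eq ψ hs.inv.1]
    refine Germ.mk_eq_mk.2 ⟨Idem.dom s⁻¹, hs.inv.1, ?_⟩
    simp only [Idem.dom, inv_inv']
  comp_inv := by
    rintro χ ψ ⟨s, hs⟩
    rw [Germ.unit_eq χ hs.1]
    exact Germ.mk_eq_mk.2 ⟨Idem.dom s, hs.1, rfl⟩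

end TightSpectrum

end InverseSemigroup

/-- The set of all arrows of a category. -/
def Arrows (C : Type u) [Category.{v} C] := Σ a b : C, a ⟶ b

/-- The map on arrows induced by a functor. -/
def arrowsMap {C : Type*} {D : Type*} [Category* C] [Category* D] (F : C ⥤ D)
    (x : Arrows C) : Arrows D := ⟨F.obj x.1, F.obj x.2.1, F.map x.2.2⟩

/-- The topology of the tight groupoid: a basis is given by the sets
`{[s, χ] : χ ∈ U, χ(s⁻¹ s) = 1}` with `s ∈ S` and `U` an open set of characters. -/
instance {S : Type u} [InverseSemigroupWithZero S] :
    TopologicalSpace (Arrows (TightSpectrum S)) :=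
  TopologicalSpace.generateFrom
    {B | ∃ (s : S) (U : Set (TightSpectrum S)), IsOpen U ∧
      B = {x | ∃ (χ ψ : TightSpectrum S) (h : TightSpectrum.Moves s χ ψ), χ ∈ U ∧
        x = ⟨χ, ψ, TightSpectrum.Germ.mk s h⟩}}

/-- Isomorphism of topological groupoids: a functor that is a homeomorphism on objects and on
arrows. -/
def TopGroupoidIso (C : Type*) (D : Type*) [Groupoid C] [Groupoid D] [TopologicalSpace C]
    [TopologicalSpace D] [TopologicalSpace (Arrows C)] [TopologicalSpace (Arrows D)] : Prop :=
  ∃ F : C ⥤ D, IsHomeomorph F.obj ∧ IsHomeomorph (arrowsMap F)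

/-! ## The inverse semigroup of a self-similar action -/

/-- The elements of the inverse semigroup of a self-similar action: zero, and the triples
`(p, g, q)` with `p`, `q` finite paths and `g` an arrow, `s(p) = r(g)` and `s(g) = s(q)`. -/
inductive Triples {V : Type u} [Groupoid.{v} V] {E : V → V → Type w} (A : SSAction E) :
    Type (max u v w)
  | zero : Triples A
  | triple {a b c d : V} (p : Path E a b) (g : c ⟶ b) (q : Path E d c) : Triples A

namespace Triples

variable {V : Type u} [Groupoid.{v} V] {E : V → V → Type w} {A : SSAction E}

open SSAction

/-- The involution `(p, g, q)* = (q, g⁻¹, p)`. -/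
def inv : Triples A → Triples A
  | zero => zero
  | triple p g q => triple q (Groupoid.inv g) p

open Classical in
/-- The product: `(p, g, q) (p', h, q')` is
`(p g(r), g|_r h, q')` if `p' = q r`, and
`(p, g h|_{h⁻¹(s)}, q' h⁻¹(s))` if `q = p' s`, and zero otherwise.
Here `h|_{h⁻¹(s)} = (h⁻¹|_s)⁻¹`. -/
noncomputable def mul : Triples A → Triples A → Triples A
  | zero, _ => zero
  | triple _ _ _, zero => zero
  | @triple _ _ _ _ _ _ c d p g q, @triple _ _ _ _ a' b' _ _ p' h q' =>
    if H : ∃ r : Path E c b', (⟨a', p'⟩ : Σ x, Path E x b') = ⟨d, q.append r⟩ then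
      triple (p.append (A.pact g H.choose).2.1) (h ≫ (A.pact g H.choose).2.2) q'
    else if H : ∃ s : Path E b' c, (⟨d, q⟩ : Σ x, Path E x c) = ⟨a', p'.append s⟩ then
      triple p (Groupoid.inv (A.pact (Groupoid.inv h) H.choose).2.2 ≫ g)
        (q'.append (A.pact (Groupoid.inv h) H.choose).2.1)
    else zero

/-! The axioms of an inverse semigroup are checked in the faithful representation by partial
injections `q z ↦ p g z` on the elements `z` of the form "path times groupoid element". -/

variable (E) in
/-- The points on which the inverse semigroup acts. -/
def Pt := Σ a c : V, Bim E a c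

/-- The partial injection `q z ↦ p g z` of the triple `(p, g, q)`. -/
def Rel : Triples A → Pt E → Pt E → Prop
  | zero, _, _ => False
  | @triple _ _ _ _ a _ c d p g q, x, y =>
    ∃ (e : V) (z : Bim E c e), x = ⟨d, e, pmul q z⟩ ∧ y = ⟨a, e, pmul p (A.gmul g z)⟩

theorem rel_inv (s : Triples A) (x y : Pt E) : Rel s.inv x y ↔ Rel s y x := by
  cases s with
  | zero => rfl
  | triple p g q =>
    constructor
    · rintro ⟨e, z, rfl, rfl⟩
      exact ⟨e, A.gmul (Groupoid.inv g) z, rfl, by rw [gmul_gmul_inv]⟩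
    · rintro ⟨e, z, rfl, rfl⟩
      exact ⟨e, A.gmul g z, rfl, by rw [gmul_inv_gmul]⟩

theorem pt_ext {a a' e e' : V} {x : Bim E a e} {x' : Bim E a' e'}
    (h : (⟨a, e, x⟩ : Pt E) = ⟨a', e', x'⟩) : a = a' ∧ e = e' ∧ HEq x x' := by
  cases h; exact ⟨rfl, rfl, HEq.rfl⟩

theorem rel_functional {s : Triples A} {x y y' : Pt E} (h : Rel s x y) (h' : Rel s x y') :
    y = y' := by
  cases s with
  | zero => exact h.elim
  | triple p g q =>
    obtain ⟨e, z, rfl, rfl⟩ := h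
    obtain ⟨e', z', h1, rfl⟩ := h'
    obtain ⟨-, rfl, h1⟩ := pt_ext h1
    rw [pmul_cancel _ (eq_of_heq h1)]

theorem inv_inv_triples (s : Triples A) : s.inv.inv = s := by
  cases s with
  | zero => rfl
  | triple p g q => simp [inv, Groupoid.inv_eq_inv]

/-- The product when `p' = q r`. -/
theorem rel_prod {a b c d b' c' d' : V} (p : Path E a b) (g : c ⟶ b) (q : Path E d c)
    (r : Path E c b') (h : c' ⟶ b') (q' : Path E d' c') (x y : Pt E) :
    Rel (A := A) (triple (p.append (A.pact g r).2.1) (h ≫ (A.pact g r).2.2) q') x y ↔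
      ∃ m, Rel (A := A) (triple (q.append r) h q') x m ∧ Rel (A := A) (triple p g q) m y := by
  constructor
  · rintro ⟨e, z, rfl, rfl⟩
    refine ⟨_, ⟨e, z, rfl, rfl⟩, e, pmul r (A.gmul h z), by rw [pmul_pmul], ?_⟩
    rw [gmul_pmul, gmul_comp, pmul_pmul]
  · rintro ⟨_, ⟨e, z, rfl, rfl⟩, e', z', h1, rfl⟩
    obtain ⟨-, rfl, h1⟩ := pt_ext h1
    have h1 := eq_of_heq h1
    rw [← pmul_pmul] at h1
    rw [← pmul_cancel _ h1]
    exact ⟨e, z, rfl, by rw [gmul_pmul, gmul_comp, pmul_pmul]⟩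

theorem rel_mul (s t : Triples A) (x y : Pt E) :
    Rel (mul s t) x y ↔ ∃ m, Rel t x m ∧ Rel s m y := by
  cases s with
  | zero => simp [mul, Rel]
  | @triple a b c d p g q =>
    cases t with
    | zero => simp [mul, Rel]
    | @triple a' b' c' d' p' h q' =>
      rw [mul]
      split_ifs with H H'
      · have hr := H.choose_spec
        generalize H.choose = r at hr ⊢
        cases hr
        exact rel_prod p g q r h q' x y
      · have hr := H'.choose_spec
        generalize H'.choose = r at hr ⊢
        cases hr
        rw [← inv_inv_triples (triple p _ _), rel_inv, inv]
        have h1 := rel_prod (A := A) q' (Groupoid.inv h) p' r (Groupoid.inv g) p y x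
        have e1 : Groupoid.inv (Groupoid.inv (A.pact (Groupoid.inv h) r).2.2 ≫ g) =
            Groupoid.inv g ≫ (A.pact (Groupoid.inv h) r).2.2 := by
          simp [Groupoid.inv_eq_inv]
        rw [e1, h1]
        constructor
        · rintro ⟨m, hm, hm'⟩
          exact ⟨m, (rel_inv (triple p' h q') m x).1 hm',
            (rel_inv (triple p g (p'.append r)) y m).1 hm⟩
        · rintro ⟨m, hm, hm'⟩
          exact ⟨m, (rel_inv (triple p g (p'.append r)) y m).2 hm',
            (rel_inv (triple p' h q') m x).2 hm⟩
      · simp only [Rel, false_iff]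
        rintro ⟨_, ⟨e, z, rfl, rfl⟩, e', z', h1, rfl⟩
        obtain ⟨rfl, rfl, h1⟩ := pt_ext h1
        have h1 := eq_of_heq h1
        generalize A.gmul h z = y at h1
        obtain ⟨f, u, k⟩ := y
        obtain ⟨f', u', k'⟩ := z'
        simp only [pmul, Sigma.mk.injEq] at h1
        obtain ⟨rfl, h1⟩ := h1
        have h1 := eq_of_heq h1
        simp only [Prod.mk.injEq] at h1
        rcases Path.comparable _ _ _ _ h1.1 with ⟨r, rfl⟩ | ⟨r, rfl⟩
        · exact H' ⟨r, rfl⟩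
        · exact H ⟨r, rfl⟩

theorem rel_injective {s t : Triples A} (h : ∀ x y, Rel s x y ↔ Rel t x y) : s = t := by
  have self : ∀ {a b c d : V} (p : Path E a b) (g : c ⟶ b) (q : Path E d c),
      Rel (A := A) (triple p g q) ⟨d, c, c, q, 𝟙 c⟩ ⟨a, c, b, p, g⟩ := by
    intro a b c d p g q
    exact ⟨c, ⟨c, .nil c, 𝟙 c⟩, by simp [pmul]; rfl, by simp [pmul, gmul]; rfl⟩
  cases s with
  | zero =>
    cases t with
    | zero => rfl
    | triple p g q => exact ((h _ _).2 (self p g q)).elim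
  | @triple a b c d p g q =>
    cases t with
    | zero => exact ((h _ _).1 (self p g q)).elim
    | @triple a' b' c' d' p' g' q' =>
      obtain ⟨e, ⟨f, u, k⟩, h1, h2⟩ := (h _ _).1 (self p g q)
      obtain ⟨e', ⟨f', u', k'⟩, h1', h2'⟩ := (h _ _).2 (self p' g' q')
      obtain ⟨rfl, rfl, h1⟩ := pt_ext h1
      obtain ⟨-, rfl, h1'⟩ := pt_ext h1'
      have h1 := eq_of_heq h1
      have h1' := eq_of_heq h1'
      simp only [pmul, Sigma.mk.injEq] at h1 h1'
      obtain ⟨rfl, h1⟩ := h1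
      obtain ⟨rfl, h1'⟩ := h1'
      have h1 := eq_of_heq h1
      have h1' := eq_of_heq h1'
      simp only [Prod.mk.injEq] at h1 h1'
      obtain ⟨h3, rfl⟩ := h1
      obtain ⟨h3', rfl⟩ := h1'
      have hl := congrArg Path.length h3
      have hl' := congrArg Path.length h3'
      rw [Path.length_append] at hl hl'
      cases u with
      | cons e u => simp [Path.length] at hl; omega
      | nil =>
        simp only [Path.append_nil] at h3
        subst h3
        simp only [pmul, gmul, pact_nil, Category.id_comp, Path.append_nil] at h2
        obtain ⟨rfl, -, h2⟩ := pt_ext h2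
        have h2 := eq_of_heq h2
        simp only [Sigma.mk.injEq] at h2
        obtain ⟨rfl, h2⟩ := h2
        have h2 := eq_of_heq h2
        simp only [Prod.mk.injEq] at h2
        obtain ⟨rfl, rfl⟩ := h2
        rfl

theorem rel_idem {s : Triples A} (h : mul s s = s) {x y : Pt E} (hx : Rel s x y) : x = y := by
  rw [← h, rel_mul] at hx
  obtain ⟨m, h1, h2⟩ := hx
  have h3 : Rel s x y := by rw [← h, rel_mul]; exact ⟨m, h1, h2⟩
  have h4 := rel_functional h1 h3
  subst h4
  exact rel_functional ((rel_inv s m x).2 h1) ((rel_inv s m m).2 h2)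

/-- The inverse semigroup with zero of a self-similar action. -/
noncomputable instance : InverseSemigroupWithZero (Triples A) where
  mul := mul
  zero := zero
  inv := inv
  zero_mul s := rfl
  mul_zero s := by cases s <;> rfl
  mul_assoc s t r := by
    change mul (mul s t) r = mul s (mul t r)
    refine rel_injective fun x y => ?_
    simp only [rel_mul]
    constructor
    · rintro ⟨m, h1, n, h2, h3⟩
      exact ⟨n, ⟨m, h1, h2⟩, h3⟩
    · rintro ⟨n, ⟨m, h1, h2⟩, h3⟩
      exact ⟨m, h1, n, h2, h3⟩
  mul_inv_mul s := by
    change mul (mul s (inv s)) s = s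
    refine rel_injective fun x y => ?_
    simp only [rel_mul, rel_inv]
    constructor
    · rintro ⟨m, h1, n, h2, h3⟩
      rwa [rel_functional ((rel_inv s m x).2 h1) ((rel_inv s m n).2 h2)]
    · intro h
      exact ⟨y, h, x, h, h⟩
  inv_mul_inv s := by
    change mul (mul (inv s) s) (inv s) = inv s
    refine rel_injective fun x y => ?_
    simp only [rel_mul, rel_inv]
    constructor
    · rintro ⟨m, h1, n, h2, h3⟩
      rwa [← rel_functional h2 h1]
    · intro h
      exact ⟨y, h, x, h, h⟩
  idem_comm e f he hf := by
    change mul e f = mul f e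
    refine rel_injective fun x y => ?_
    simp only [rel_mul]
    constructor
    · rintro ⟨m, h1, h2⟩
      obtain rfl := rel_idem hf h1
      obtain rfl := rel_idem he h2
      exact ⟨x, h2, h1⟩
    · rintro ⟨m, h1, h2⟩
      obtain rfl := rel_idem he h1
      obtain rfl := rel_idem hf h2
      exact ⟨x, h2, h1⟩

end Triples

/-- The tight groupoid `𝒢_{(G,E)}` of the inverse semigroup of a self-similar action; given by its
object space, the groupoid structure and the topologies being those of `TightSpectrum`. -/
abbrev SSAction.TightGroupoid {V : Type u} [Groupoid.{v} V] {E : V → V → Type w} (A : SSAction E) :=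
  TightSpectrum (Triples A)

end SelfSim

/-! The tight spectrum of an inverse semigroup is built from its semilattice of idempotents alone;
the rest of the semigroup enters only through conjugation and germs. A surjective zero-preserving
homomorphism `π : S → T` that is injective on idempotents therefore identifies the two spaces of
tight characters, together with the conjugation actions, and `[s, χ] ↦ [π s, χ]` is a functor which
is onto on germs and carries basic open sets to basic open sets. It is an isomorphism of topological
groupoids as soon as it is injective on germs, for which it suffices that elements with the same
image under `π` agree near each tight character in their domain (`ReflectsGerms`). This is
`IsSeparatingHom.topGroupoidIso`.

For every `K : A.Normal`, the map `(p, g, q) ↦ (p, g K, q)` is such a homomorphism, because the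
nonzero idempotents are the `(p, s(p), p)` and these involve no group element
(`toQuotient_isSeparatingHom`). Tightness is needed for germs: two triples with the same image are
`(p, g, q)` and `(p, g k, q)` with `k ∈ K`. If `χ(q, s(q), q) = 1` and `s(q)` is regular, the
finitely many edges at `s(q)` give a cover, so `χ` is also supported at some `q e`. For `k ∈ K_n`,
repeating this reaches, after at most `n` edges, a path `q r` in the support of `χ` with `k(r) = r`
and `k|_r` a unit: either `r` has length `n` or the extension stopped at a singular vertex, and the
definition of `K_n` covers both. Multiplying by `(q r, s(r), q r)` makes the two triples equal.
Hence the tight kernel reflects germs.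

Part (1) reduces to `K = N`. Sections of `g ∈ N` lie in `N`, and at long paths they lie in the
nucleus, so they are units there and `g ∈ K`. The other inclusion holds because the levels `K_n`
increase. -/

namespace SelfSim

/-! ## Idempotent-separating homomorphisms and tight groupoids -/

section SeparatingHom

open InverseSemigroupWithZero TightSpectrum

universe u'

variable {S : Type u} {T : Type u'} [InverseSemigroupWithZero S] [InverseSemigroupWithZero T]

/-- A surjective homomorphism of inverse semigroups with zero that is injective on idempotents. -/
structure IsSeparatingHom (π : S → T) : Prop where
  map_zero : π 0 = 0
  map_mul : ∀ s t, π (s * t) = π s * π t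
  surjective : Function.Surjective π
  separating : ∀ e f : S, e * e = e → f * f = f → π e = π f → e = f

namespace IsSeparatingHom

variable {π : S → T}

/-! ### The semilattice of idempotents -/

theorem map_inv (hπ : IsSeparatingHom π) (s : S) : π s⁻¹ = (π s)⁻¹ :=
  inv_unique (by rw [← hπ.map_mul, ← hπ.map_mul, mul_inv_mul])
    (by rw [← hπ.map_mul, ← hπ.map_mul, inv_mul_inv])

/-- The isomorphism of the semilattices of idempotents. -/
noncomputable def idemEquiv (hπ : IsSeparatingHom π) : Idem S ≃ Idem T :=
  Equiv.ofBijective (fun e => ⟨π e.1, by rw [← hπ.map_mul, e.2]⟩) <| by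
    refine ⟨fun e f h => Idem.ext (hπ.separating _ _ e.2 f.2 (congrArg Subtype.val h)),
      fun e => ?_⟩
    obtain ⟨s, hs⟩ := hπ.surjective e.1
    -- The preimage `s` need not be idempotent, but `s⁻¹ s` is, and its image is `e⁻¹ e = e`.
    refine ⟨Idem.dom s, Idem.ext ?_⟩
    have h := Idem.dom_idem e
    change π (s⁻¹ * s) = e.1
    rw [hπ.map_mul, hπ.map_inv, hs]
    exact congrArg Subtype.val h

theorem val_idemEquiv (hπ : IsSeparatingHom π) (e : Idem S) : (hπ.idemEquiv e).1 = π e.1 := rfl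

theorem idemEquiv_mul (hπ : IsSeparatingHom π) (e f : Idem S) :
    hπ.idemEquiv (e * f) = hπ.idemEquiv e * hπ.idemEquiv f :=
  Idem.ext (hπ.map_mul _ _)

theorem idemEquiv_zero (hπ : IsSeparatingHom π) : hπ.idemEquiv 0 = 0 := Idem.ext hπ.map_zero

theorem idemEquiv_dom (hπ : IsSeparatingHom π) (s : S) :
    hπ.idemEquiv (Idem.dom s) = Idem.dom (π s) :=
  Idem.ext (by rw [val_idemEquiv]; simp only [Idem.dom]; rw [hπ.map_mul, hπ.map_inv])

theorem idemEquiv_conj (hπ : IsSeparatingHom π) (s : S) (e : Idem S) :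
    hπ.idemEquiv (Idem.conj s e) = Idem.conj (π s) (hπ.idemEquiv e) :=
  Idem.ext (by
    rw [val_idemEquiv]; simp only [Idem.conj]
    rw [hπ.map_mul, hπ.map_mul, hπ.map_inv, val_idemEquiv])

theorem idemEquiv_le (hπ : IsSeparatingHom π) {e f : Idem S} :
    hπ.idemEquiv e ≤ hπ.idemEquiv f ↔ e ≤ f := by
  change hπ.idemEquiv e * hπ.idemEquiv f = hπ.idemEquiv e ↔ e * f = e
  rw [← idemEquiv_mul, hπ.idemEquiv.injective.eq_iff]

/-! ### Characters and tight characters -/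

theorem isCharacter_comp (hπ : IsSeparatingHom π) {χ : Idem T → Bool} :
    IsCharacter (χ ∘ hπ.idemEquiv) ↔ IsCharacter χ := by
  constructor
  · rintro ⟨⟨e, he⟩, h0, hm⟩
    refine ⟨⟨_, he⟩, ?_, fun e f => ?_⟩
    · rwa [Function.comp_apply, idemEquiv_zero] at h0
    · obtain ⟨e, rfl⟩ := hπ.idemEquiv.surjective e
      obtain ⟨f, rfl⟩ := hπ.idemEquiv.surjective f
      rw [← idemEquiv_mul]; exact hm e f
  · rintro ⟨⟨e, he⟩, h0, hm⟩
    refine ⟨⟨hπ.idemEquiv.symm e, by simpa using he⟩, ?_, fun e f => ?_⟩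
    · rwa [Function.comp_apply, idemEquiv_zero]
    · simp only [Function.comp_apply]
      rw [idemEquiv_mul, hm]

/-- Tightness refers only to products, the order and zero, all of which the isomorphism of
semilattices preserves and reflects; finite covers are carried to finite covers in both directions.
-/
theorem isTight_comp (hπ : IsSeparatingHom π) {χ : Idem T → Bool} :
    IsTight (χ ∘ hπ.idemEquiv) ↔ IsTight χ := by
  have zero : ∀ {f : Idem S}, hπ.idemEquiv f ≠ 0 ↔ f ≠ 0 := by
    intro f
    rw [← hπ.idemEquiv_zero, hπ.idemEquiv.injective.ne_iff]
  constructor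
  · intro h e F hF hc
    obtain ⟨e, rfl⟩ := hπ.idemEquiv.surjective e
    have h := h e (F.map hπ.idemEquiv.symm.toEmbedding) ?_ ?_
    · simp only [Finset.mem_map_equiv, Equiv.symm_symm, Function.comp_apply] at h
      rwa [hπ.idemEquiv.exists_congr_right (q := fun f => f ∈ F ∧ χ f = true)] at h
    · simp only [Finset.mem_map_equiv, Equiv.symm_symm]
      exact fun f hf => hπ.idemEquiv_le.1 (hF _ hf)
    · intro f hf hfe
      obtain ⟨f', h1, h2⟩ := hc (hπ.idemEquiv f) (zero.2 hf) (hπ.idemEquiv_le.2 hfe)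
      obtain ⟨f', rfl⟩ := hπ.idemEquiv.surjective f'
      refine ⟨f', by simpa using h1, ?_⟩
      rwa [← idemEquiv_mul, zero] at h2
  · intro h e F hF hc
    have h := h (hπ.idemEquiv e) (F.map hπ.idemEquiv.toEmbedding) ?_ ?_
    · refine h.trans ⟨?_, fun ⟨f, hf, hχ⟩ => ⟨_, Finset.mem_map_of_mem _ hf, hχ⟩⟩
      rintro ⟨_, hf, hχ⟩
      obtain ⟨f, hf', rfl⟩ := Finset.mem_map.1 hf
      exact ⟨f, hf', hχ⟩
    · intro f hf
      obtain ⟨f, hf', rfl⟩ := Finset.mem_map.1 hf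
      exact hπ.idemEquiv_le.2 (hF _ hf')
    · intro f hf hfe
      obtain ⟨f, rfl⟩ := hπ.idemEquiv.surjective f
      obtain ⟨f', h1, h2⟩ := hc f (zero.1 hf) (hπ.idemEquiv_le.1 hfe)
      refine ⟨hπ.idemEquiv f', Finset.mem_map_of_mem _ h1, ?_⟩
      rwa [← idemEquiv_mul, zero]

theorem comp_symm_mem (hπ : IsSeparatingHom π) (χ : TightSpectrum S) :
    IsCharacter (χ.1 ∘ hπ.idemEquiv.symm) ∧ IsTight (χ.1 ∘ hπ.idemEquiv.symm) := by
  rw [← hπ.isCharacter_comp, ← hπ.isTight_comp]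
  simpa [Function.comp_assoc] using χ.2

theorem comp_mem (hπ : IsSeparatingHom π) (χ : TightSpectrum T) :
    IsCharacter (χ.1 ∘ hπ.idemEquiv) ∧ IsTight (χ.1 ∘ hπ.idemEquiv) :=
  ⟨hπ.isCharacter_comp.2 χ.2.1, hπ.isTight_comp.2 χ.2.2⟩

theorem continuous_eval (e : Idem S) : Continuous fun χ : TightSpectrum S => χ.1 e :=
  (continuous_apply e).comp continuous_subtype_val

/-- The homeomorphism of the spaces of tight characters. -/
noncomputable def spectrumHomeomorph (hπ : IsSeparatingHom π) :
    TightSpectrum S ≃ₜ TightSpectrum T where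
  toFun χ := ⟨χ.1 ∘ hπ.idemEquiv.symm, hπ.comp_symm_mem χ⟩
  invFun χ := ⟨χ.1 ∘ hπ.idemEquiv, hπ.comp_mem χ⟩
  left_inv χ := Subtype.ext (by simp [Function.comp_assoc])
  right_inv χ := Subtype.ext (by simp [Function.comp_assoc])
  continuous_toFun := Continuous.subtype_mk (f := fun χ : TightSpectrum S => χ.1 ∘ hπ.idemEquiv.symm)
    (continuous_pi fun e => continuous_eval (hπ.idemEquiv.symm e)) hπ.comp_symm_mem
  continuous_invFun := Continuous.subtype_mk (f := fun χ : TightSpectrum T => χ.1 ∘ hπ.idemEquiv)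
    (continuous_pi fun e => continuous_eval (hπ.idemEquiv e)) hπ.comp_mem

theorem spectrumHomeomorph_apply (hπ : IsSeparatingHom π) (χ : TightSpectrum S) (e : Idem S) :
    (hπ.spectrumHomeomorph χ).1 (hπ.idemEquiv e) = χ.1 e :=
  congrArg χ.1 (hπ.idemEquiv.symm_apply_apply e)

/-- The isomorphism of semilattices intertwines `Idem.dom` and `Idem.conj`, the only data in
`Moves`. The reverse implication makes every lift `s` of `t` move the same characters as `t`, which
gives surjectivity on germs. -/
theorem moves_iff (hπ : IsSeparatingHom π) {s : S} {χ ψ : TightSpectrum S} :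
    Moves (π s) (hπ.spectrumHomeomorph χ) (hπ.spectrumHomeomorph ψ) ↔ Moves s χ ψ := by
  unfold Moves
  rw [← hπ.idemEquiv_dom, spectrumHomeomorph_apply, ← hπ.idemEquiv.forall_congr_right]
  simp only [← hπ.idemEquiv_conj, spectrumHomeomorph_apply]

/-! ### Germs and the functor of tight groupoids -/

theorem eq_of_idem (hπ : IsSeparatingHom π) {s t : S} {χ ψ : TightSpectrum S}
    {hs : Moves s χ ψ} {ht : Moves t χ ψ} (h : Germ.mk s hs = Germ.mk t ht) :
    Germ.mk (π s) (hπ.moves_iff.2 hs) = Germ.mk (π t) (hπ.moves_iff.2 ht) := by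
  obtain ⟨e, he, h⟩ := Germ.mk_eq_mk.1 h
  refine Germ.mk_eq_mk.2 ⟨hπ.idemEquiv e, by rwa [spectrumHomeomorph_apply], ?_⟩
  rw [val_idemEquiv, ← hπ.map_mul, ← hπ.map_mul, h]

/-- The map `[s, χ] ↦ [π s, χ]` on germs. -/
noncomputable def germMap (hπ : IsSeparatingHom π) {χ ψ : TightSpectrum S} (g : Germ χ ψ) :
    Germ (hπ.spectrumHomeomorph χ) (hπ.spectrumHomeomorph ψ) :=
  Quotient.liftOn g (fun s => Germ.mk (π s.1) (hπ.moves_iff.2 s.2)) fun s t h =>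
    hπ.eq_of_idem (hs := s.2) (ht := t.2) (Quotient.sound h)

/-- The functor of tight groupoids. -/
noncomputable def functor (hπ : IsSeparatingHom π) : TightSpectrum S ⥤ TightSpectrum T where
  obj := hπ.spectrumHomeomorph
  map g := hπ.germMap g
  map_id χ := by
    obtain ⟨e, he⟩ := χ.2.1.nonzero
    have he' := he
    rw [← hπ.spectrumHomeomorph_apply] at he'
    change hπ.germMap (Germ.unit χ) = Germ.unit _
    -- The two units are germs of independently chosen idempotents; both are replaced by germs of
    -- `e` and of its image.
    rw [Germ.unit_eq χ he, Germ.unit_eq _ he']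
    rfl
  map_comp := by
    rintro χ ψ ω ⟨s, hs⟩ ⟨t, ht⟩
    exact Germ.mk_eq_mk.2 ⟨Idem.dom (π (t * s)), (hπ.moves_iff.2 (hs.mul ht)).1,
      by rw [hπ.map_mul]⟩

/-- The condition on germs under which the functor of tight groupoids is faithful: elements with
the same image agree near every tight character in their domains. -/
def ReflectsGerms (π : S → T) : Prop :=
  ∀ (χ : TightSpectrum S) (s t : S), χ.1 (Idem.dom s) = true → π s = π t →
    ∃ e : Idem S, χ.1 e = true ∧ s * e.1 = t * e.1

/-- Equal germs of `π s` and `π t` only mean that `π s` and `π t` agree after multiplication by an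
idempotent. That idempotent is the image of some `e`, so `s e` and `t e` have the same image, and
the hypothesis on germs applies to them. -/
theorem germMap_injective (hπ : IsSeparatingHom π) (H : ReflectsGerms π) {χ ψ : TightSpectrum S} :
    Function.Injective (hπ.germMap (χ := χ) (ψ := ψ)) := by
  rintro ⟨s, hs⟩ ⟨t, ht⟩ h
  obtain ⟨e, he, h⟩ := Germ.mk_eq_mk.1 h
  obtain ⟨e, rfl⟩ := hπ.idemEquiv.surjective e
  rw [spectrumHomeomorph_apply] at he
  simp only [val_idemEquiv, ← hπ.map_mul] at h
  obtain ⟨f, hf, h⟩ := H χ (s * e.1) (t * e.1)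
    -- The domain idempotent of `s e` is `e` times that of `s`, and `χ` is 1 on both factors.
    (by rw [← Idem.conj_dom, Idem.conj_idem, χ.2.1.map_mul, he, hs.1]; rfl) h
  refine Germ.mk_eq_mk.2 ⟨e * f, by rw [χ.2.1.map_mul, he, hf]; rfl, ?_⟩
  simpa only [Idem.val_mul, mul_assoc] using h

theorem arrowsMap_bijective (hπ : IsSeparatingHom π) (H : ReflectsGerms π) :
    Function.Bijective (arrowsMap hπ.functor) := by
  constructor
  · rintro ⟨χ, ψ, g⟩ ⟨χ', ψ', g'⟩ h
    obtain ⟨h1, h⟩ := Sigma.mk.inj_iff.1 h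
    simp only at h1 h
    obtain rfl := hπ.spectrumHomeomorph.injective h1
    have h := eq_of_heq h
    simp only [Sigma.mk.injEq] at h
    obtain ⟨h2, h⟩ := h
    obtain rfl := hπ.spectrumHomeomorph.injective h2
    rw [hπ.germMap_injective H (eq_of_heq h)]
  · rintro ⟨χ, ψ, t, ht⟩
    obtain ⟨χ, rfl⟩ := hπ.spectrumHomeomorph.surjective χ
    obtain ⟨ψ, rfl⟩ := hπ.spectrumHomeomorph.surjective ψ
    obtain ⟨s, rfl⟩ := hπ.surjective t
    exact ⟨⟨χ, ψ, Germ.mk s (hπ.moves_iff.1 ht)⟩, rfl⟩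

/-! ### The topology on arrows -/

/-- The basic open set `{[s, χ] : χ ∈ U, χ(s⁻¹ s) = 1}` of the tight groupoid. -/
def basicOpen (s : S) (U : Set (TightSpectrum S)) : Set (Arrows (TightSpectrum S)) :=
  {x | ∃ (χ ψ : TightSpectrum S) (h : Moves s χ ψ), χ ∈ U ∧ x = ⟨χ, ψ, Germ.mk s h⟩}

theorem isOpen_basicOpen (s : S) {U : Set (TightSpectrum S)} (hU : IsOpen U) :
    IsOpen (basicOpen s U) :=
  TopologicalSpace.isOpen_generateFrom_of_mem ⟨s, U, hU, rfl⟩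

/-- A germ of `π s` is the image of the germ of `s` itself at the corresponding character, so no
condition on germs is needed here. -/
theorem image_basicOpen (hπ : IsSeparatingHom π) (s : S) (U : Set (TightSpectrum S)) :
    arrowsMap hπ.functor '' basicOpen s U = basicOpen (π s) (hπ.spectrumHomeomorph '' U) := by
  ext x
  constructor
  · rintro ⟨_, ⟨χ, ψ, h, hU, rfl⟩, rfl⟩
    exact ⟨_, _, hπ.moves_iff.2 h, ⟨χ, hU, rfl⟩, rfl⟩
  · rintro ⟨_, ψ, h, ⟨χ, hU, rfl⟩, rfl⟩
    obtain ⟨ψ, rfl⟩ := hπ.spectrumHomeomorph.surjective ψ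
    exact ⟨_, ⟨χ, ψ, hπ.moves_iff.1 h, hU, rfl⟩, rfl⟩

/-- A surjective idempotent-separating homomorphism that reflects germs induces an isomorphism of
tight groupoids. -/
theorem topGroupoidIso (hπ : IsSeparatingHom π) (H : ReflectsGerms π) :
    TopGroupoidIso (TightSpectrum S) (TightSpectrum T) := by
  have hb := hπ.arrowsMap_bijective H
  refine ⟨hπ.functor, hπ.spectrumHomeomorph.isHomeomorph, ?_, ?_, hb⟩
  · refine continuous_generateFrom_iff.2 ?_
    rintro _ ⟨t, U, hU, rfl⟩
    obtain ⟨s, rfl⟩ := hπ.surjective t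
    -- The basic set of `π s` and `U` is the image of the basic set of `s` and the preimage of `U`;
    -- by injectivity, its preimage is that basic set.
    have h := hπ.image_basicOpen s (hπ.spectrumHomeomorph ⁻¹' U)
    rw [Set.image_preimage_eq _ hπ.spectrumHomeomorph.surjective] at h
    change IsOpen (_ ⁻¹' basicOpen (π s) U)
    rw [← h, Set.preimage_image_eq _ hb.1]
    exact isOpen_basicOpen s (hU.preimage hπ.spectrumHomeomorph.continuous)
  -- Openness of the bijection is continuity of its inverse, which can be tested on generating sets.
  · refine (Equiv.continuous_symm_iff (Equiv.ofBijective _ hb)).1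
      (continuous_generateFrom_iff.2 ?_)
    rintro _ ⟨s, U, hU, rfl⟩
    rw [← Equiv.image_eq_preimage_symm]
    change IsOpen (arrowsMap hπ.functor '' basicOpen s U)
    rw [hπ.image_basicOpen]
    exact isOpen_basicOpen _ (hπ.spectrumHomeomorph.isOpenMap U hU)

end IsSeparatingHom

end SeparatingHom

end SelfSim

namespace SelfSim

/-! ## The quotient map of the inverse semigroups -/

namespace SSAction.Normal

variable {V : Type u} [Groupoid.{v} V] {E : V → V → Type w} {A : SSAction E} (K : A.Normal)

/-- A path of `E`, as a path of the same graph on the objects of `G/K`. -/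
def mapPath : {a b : V} → Path E a b → Path K.graph ⟨a⟩ ⟨b⟩
  | _, _, .nil a => .nil (⟨a⟩ : K.Quo)
  | _, _, .cons (a := a) (b := b) e p => .cons (a := (⟨a⟩ : K.Quo)) (b := (⟨b⟩ : K.Quo)) e (mapPath p)

/-- The inverse of `mapPath`. -/
def liftPath : {a b : K.Quo} → Path K.graph a b → Path E a.as b.as
  | _, _, .nil a => .nil a.as
  | _, _, .cons e p => .cons e (liftPath p)

theorem liftPath_mapPath {a b : V} (p : Path E a b) : K.liftPath (K.mapPath p) = p := by
  induction p with
  | nil => rfl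
  | cons e p ih => simp only [mapPath, liftPath, ih]

theorem mapPath_liftPath {a b : K.Quo} (p : Path K.graph a b) :
    K.mapPath (K.liftPath p) = p := by
  induction p with
  | nil => rfl
  | cons e p ih => simp only [mapPath, liftPath, ih]

theorem mapPath_injective {a b : V} : Function.Injective (K.mapPath (a := a) (b := b)) :=
  Function.LeftInverse.injective K.liftPath_mapPath

theorem mapPath_append {a b c : V} (p : Path E a b) (q : Path E b c) :
    K.mapPath (p.append q) = (K.mapPath p).append (K.mapPath q) := by
  induction p with
  | nil => rfl
  | cons e p ih => simp only [mapPath, Path.cons_append, ih]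

theorem liftPath_append {a b c : K.Quo} (p : Path K.graph a b) (q : Path K.graph b c) :
    K.liftPath (p.append q) = (K.liftPath p).append (K.liftPath q) := by
  induction p with
  | nil => rfl
  | cons e p ih => simp only [liftPath, Path.cons_append, ih]

/-! ### The action of the quotient on paths -/

/-- The action of `G/K` on an edge is computed on a representative, so one step of the recursion
unfolds definitionally; induction on the path does the rest. -/
theorem quotient_pact {a b c : V} (g : a ⟶ b) (p : Path E a c) :
    K.quotient.pact (K.cls g) (K.mapPath p) =
      ⟨⟨(A.pact g p).1⟩, K.mapPath (A.pact g p).2.1, K.cls (A.pact g p).2.2⟩ := by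
  induction p generalizing b with
  | nil => rfl
  | cons e p ih =>
    have h : K.quotient.pact (K.cls g) (K.mapPath (.cons e p)) =
        (⟨(K.quotient.pact (K.cls (A.act g e).2.2) (K.mapPath p)).1,
          .cons (A.act g e).2.1 (K.quotient.pact (K.cls (A.act g e).2.2) (K.mapPath p)).2.1,
          (K.quotient.pact (K.cls (A.act g e).2.2) (K.mapPath p)).2.2⟩ :
          Σ d : K.Quo, Path K.graph ⟨b⟩ d × (_ ⟶ d)) := rfl
    rw [h, ih]
    rfl

theorem cls_eq_iff {a b : V} {g h : a ⟶ b} :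
    K.cls g = K.cls h ↔ ∃ k ∈ K.carrier a, h = k ≫ g :=
  CategoryTheory.Quotient.functor_map_eq_iff K.rel g h

theorem cls_surjective {a b : K.Quo} (g : a ⟶ b) : ∃ g' : a.as ⟶ b.as, K.cls g' = g :=
  (CategoryTheory.Quotient.functor K.rel).map_surjective g

theorem exists_pact {a c : V} {g : a ⟶ a} (p : Path E a c) (hg : g ∈ K.carrier a) :
    ∃ k ∈ K.carrier c, A.pact g p = ⟨c, p, k⟩ := by
  induction p with
  | nil => exact ⟨g, hg, rfl⟩
  | cons e p ih =>
    obtain ⟨l, hl, h⟩ := K.act_mem e hg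
    obtain ⟨k, hk, h'⟩ := ih hl
    exact ⟨k, hk, A.pact_cons_of_act h h'⟩

/-- All other fields are propositions. The equality makes it possible to replace `G/K` by `G/N` in a
statement when only the carriers are known to agree. -/
theorem ext_carrier {K L : A.Normal} (h : ∀ a, K.carrier a = L.carrier a) : K = L := by
  cases K
  cases L
  simp only [mk.injEq]
  exact funext h

end SSAction.Normal

/-- A condition on `g` at `e q` is the condition on `g|_e` at `q`, with lengths shifted by one.
Unlike the invariance of the whole tight kernel, this records the drop in level on which the
induction over `n` runs. -/
theorem SSAction.exists_act_of_mem_tightLevel_succ {V : Type u} [Groupoid.{v} V]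
    {E : V → V → Type w} (A : SSAction E) {n : ℕ} {a c : V} {g : a ⟶ a}
    (hg : g ∈ A.tightLevel (n + 1) a) (e : E a c) :
    ∃ k ∈ A.tightLevel n c, A.act g e = ⟨c, e, k⟩ := by
  obtain ⟨k, hk, -⟩ := hg c (.cons e (.nil c)) (by simp [Path.length])
  obtain ⟨l, hl, -⟩ := A.act_eq_of_pact hk
  refine ⟨l, fun d q hq => ?_, hl⟩
  obtain ⟨k', hk', h'⟩ := hg d (.cons e q) (by simpa [Path.length] using hq)
  obtain ⟨l', hl', h''⟩ := A.act_eq_of_pact hk'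
  rw [hl] at hl'
  simp only [Sigma.mk.injEq, heq_eq_eq, Prod.mk.injEq, true_and] at hl'
  subst hl'
  exact ⟨k', h'', fun h3 => h' (by simpa [Path.length] using h3)⟩

/-! ### The homomorphism of inverse semigroups -/

namespace Triples

open SSAction

variable {V : Type u} [Groupoid.{v} V] {E : V → V → Type w} {A : SSAction E}

/-- The product is defined with a chosen remainder `r`; comparing partial injections gives the
formula for the `r` at hand, without unfolding the choice. -/
theorem triple_mul_triple_append {a b c d b' c' d' : V} (p : Path E a b) (g : c ⟶ b)
    (q : Path E d c) (r : Path E c b') (h : c' ⟶ b') (q' : Path E d' c') :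
    (triple p g q * triple (q.append r) h q' : Triples A) =
      triple (p.append (A.pact g r).2.1) (h ≫ (A.pact g r).2.2) q' :=
  rel_injective fun x y => (rel_mul _ _ x y).trans (rel_prod p g q r h q' x y).symm

theorem inv_triple {a b c d : V} (p : Path E a b) (g : c ⟶ b) (q : Path E d c) :
    (triple p g q : Triples A)⁻¹ = triple q (Groupoid.inv g) p := rfl

/-- The involution reverses products and so turns this case into the previous one. -/
theorem triple_append_mul_triple {a b c a' b' c' d' : V} (p : Path E a b) (g : c ⟶ b)
    (p' : Path E a' b') (r : Path E b' c) (h : c' ⟶ b') (q' : Path E d' c') :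
    (triple p g (p'.append r) * triple p' h q' : Triples A) =
      triple p (Groupoid.inv (A.pact (Groupoid.inv h) r).2.2 ≫ g)
        (q'.append (A.pact (Groupoid.inv h) r).2.1) := by
  rw [← inv_inv' (_ * _), mul_inv_rev', inv_triple, inv_triple, triple_mul_triple_append,
    inv_triple]
  simp [Groupoid.inv_eq_inv]

theorem triple_mul_triple_eq_zero {a b c d a' b' c' d' : V} (p : Path E a b) (g : c ⟶ b)
    (q : Path E d c) (p' : Path E a' b') (h : c' ⟶ b') (q' : Path E d' c')
    (H : ¬ ∃ r : Path E c b', (⟨a', p'⟩ : Σ x, Path E x b') = ⟨d, q.append r⟩)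
    (H' : ¬ ∃ s : Path E b' c, (⟨d, q⟩ : Σ x, Path E x c) = ⟨a', p'.append s⟩) :
    (triple p g q * triple p' h q' : Triples A) = 0 := by
  change mul _ _ = zero
  rw [mul, dif_neg H, dif_neg H']

variable (K : A.Normal)

/-- The homomorphism `(p, g, q) ↦ (p, g K, q)`. -/
def toQuotient : Triples A → Triples K.quotient
  | zero => zero
  | triple p g q => triple (K.mapPath p) (K.cls g) (K.mapPath q)

theorem toQuotient_mul (s t : Triples A) :
    toQuotient K (s * t) = toQuotient K s * toQuotient K t := by
  cases s with
  | zero => rfl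
  | @triple a b c d p g q =>
    cases t with
    | zero => rfl
    | @triple a' b' c' d' p' h q' =>
      by_cases H : ∃ r : Path E c b', (⟨a', p'⟩ : Σ x, Path E x b') = ⟨d, q.append r⟩
      · obtain ⟨r, hr⟩ := H
        cases hr
        rw [triple_mul_triple_append]
        simp only [toQuotient, K.mapPath_append]
        rw [triple_mul_triple_append, K.quotient_pact]
        rfl
      by_cases H' : ∃ s : Path E b' c, (⟨d, q⟩ : Σ x, Path E x c) = ⟨a', p'.append s⟩
      · obtain ⟨r, hr⟩ := H'
        cases hr
        rw [triple_append_mul_triple]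
        simp only [toQuotient, K.mapPath_append]
        rw [triple_append_mul_triple]
        -- The inverse of a class is the class of the inverse by definition; in this form
        -- `quotient_pact` applies.
        change _ = triple _ (Groupoid.inv
          (K.quotient.pact (K.cls (Groupoid.inv h)) (K.mapPath r)).2.2 ≫ _)
          (Path.append _ (K.quotient.pact (K.cls (Groupoid.inv h)) (K.mapPath r)).2.1)
        rw [K.quotient_pact]
        rfl
      · rw [triple_mul_triple_eq_zero _ _ _ _ _ _ H H']
        refine (triple_mul_triple_eq_zero _ _ _ _ _ _ ?_ ?_).symm
        -- The quotient has the same paths, so a factorization there lifts to one in `E`: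
        -- incomparable paths stay incomparable.
        · rintro ⟨r, hr⟩
          refine H ⟨K.liftPath r, ?_⟩
          have := congrArg (fun x : Σ x, Path K.graph x ⟨b'⟩ =>
            (⟨x.1.as, K.liftPath x.2⟩ : Σ x, Path E x b')) hr
          simpa only [K.liftPath_append, K.liftPath_mapPath] using this
        · rintro ⟨r, hr⟩
          refine H' ⟨K.liftPath r, ?_⟩
          have := congrArg (fun x : Σ x, Path K.graph x ⟨c⟩ =>
            (⟨x.1.as, K.liftPath x.2⟩ : Σ x, Path E x c)) hr
          simpa only [K.liftPath_append, K.liftPath_mapPath] using this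

/-! ### Idempotents and their order -/

/-- The idempotent `(p, s(p), p)`. -/
def idem (A : SSAction E) {a b : V} (p : Path E a b) : Idem (Triples A) :=
  ⟨triple p (𝟙 b) p, by
    have h := triple_mul_triple_append (A := A) p (𝟙 b) p (.nil b) (𝟙 b) p
    simpa using! h⟩

theorem val_idem {a b : V} (p : Path E a b) : (idem A p).1 = triple p (𝟙 b) p := rfl

theorem dom_triple {a b c d : V} (p : Path E a b) (g : c ⟶ b) (q : Path E d c) :
    Idem.dom (triple p g q : Triples A) = idem A q := by
  refine Idem.ext ?_
  have h := triple_mul_triple_append (A := A) q (Groupoid.inv g) p (.nil b) g q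
  rw [Path.append_nil] at h
  exact h.trans (by simp [val_idem, Groupoid.inv_eq_inv])

theorem rel_self {a b c d : V} (p : Path E a b) (g : c ⟶ b) (q : Path E d c) :
    Rel (A := A) (triple p g q) ⟨d, c, c, q, 𝟙 c⟩ ⟨a, c, b, p, g⟩ :=
  ⟨c, ⟨c, .nil c, 𝟙 c⟩, by simp [pmul]; rfl, by simp [pmul, gmul]; rfl⟩

/-- An idempotent acts as a partial identity, while `(p, g, q)` sends the point `q` to `p g`; hence
`p = q` and `g` is a unit. -/
theorem idem_cases (e : Idem (Triples A)) : e = 0 ∨ ∃ (a b : V) (p : Path E a b), e = idem A p := by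
  obtain ⟨s, hs⟩ := e
  cases s with
  | zero => exact Or.inl rfl
  | triple p g q =>
    have h := rel_idem hs (rel_self p g q)
    obtain ⟨rfl, -, h⟩ := pt_ext h
    have h := eq_of_heq h
    cases h
    exact Or.inr ⟨_, _, _, rfl⟩

theorem idem_ne_zero {a b : V} (p : Path E a b) : idem A p ≠ 0 := by
  intro h
  have h : triple p (𝟙 b) p = (zero : Triples A) := congrArg Subtype.val h
  cases h

theorem idem_mul_idem_append {a b c : V} (p : Path E a b) (q : Path E b c) :
    idem A p * idem A (p.append q) = idem A (p.append q) := by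
  refine Idem.ext ?_
  rw [Idem.val_mul, val_idem, val_idem, triple_mul_triple_append, A.pact_id]
  simp

theorem mul_comm_idem {S : Type u} [InverseSemigroupWithZero S] (e f : Idem S) : e * f = f * e :=
  Idem.ext (InverseSemigroupWithZero.idem_comm _ _ e.2 f.2)

theorem idem_append_le {a b c : V} (p : Path E a b) (q : Path E b c) :
    idem A (p.append q) ≤ idem A p := by
  change _ * _ = _
  rw [mul_comm_idem, idem_mul_idem_append]

/-- The point `p` lies in the domain of the smaller idempotent, hence in that of `(q, s(q), q)`,
which consists of the points beginning with `q`. -/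
theorem exists_append_of_idem_le {a b a' b' : V} {p : Path E a b} {q : Path E a' b'}
    (h : idem A p ≤ idem A q) :
    ∃ (h : a' = a) (r : Path E b' b), p = (h ▸ q).append r := by
  have h : mul (triple p (𝟙 b) p) (triple q (𝟙 b') q) = (triple p (𝟙 b) p : Triples A) :=
    congrArg Subtype.val h
  have h1 := rel_self (A := A) p (𝟙 b) p
  obtain ⟨m, ⟨e, ⟨d, r, k⟩, h1, -⟩, -⟩ := (rel_mul _ _ _ _).1 (h.symm ▸ h1)
  obtain ⟨rfl, rfl, h1⟩ := pt_ext h1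
  have h1 := eq_of_heq h1
  simp only [pmul, Sigma.mk.injEq] at h1
  obtain ⟨rfl, h1⟩ := h1
  have h1 := eq_of_heq h1
  simp only [Prod.mk.injEq] at h1
  exact ⟨rfl, r, h1.1⟩

theorem toQuotient_isSeparatingHom : IsSeparatingHom (toQuotient K) where
  map_zero := rfl
  map_mul := toQuotient_mul K
  surjective s := by
    cases s with
    | zero => exact ⟨zero, rfl⟩
    | triple p g q =>
      obtain ⟨g, rfl⟩ := K.cls_surjective g
      exact ⟨triple (K.liftPath p) g (K.liftPath q), by
        simp only [toQuotient, K.mapPath_liftPath]⟩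
  separating e f he hf h := by
    rcases idem_cases ⟨e, he⟩ with h1 | ⟨a, b, p, h1⟩ <;>
    rcases idem_cases ⟨f, hf⟩ with h2 | ⟨a', b', p', h2⟩ <;>
    obtain rfl := congrArg Subtype.val h1 <;>
    obtain rfl := congrArg Subtype.val h2
    · rfl
    · cases h
    · cases h
    · injection h with ha hb _ _ hp
      cases ha
      cases hb
      rw [K.mapPath_injective (eq_of_heq hp)]

/-! ### Tight characters and the tight kernel -/

/-- If a tight character is supported at the vertex `(p, s(p), p)` with `s(p)` regular, it is
supported at an edge. -/
theorem exists_edge_of_isTight {χ : Idem (Triples A) → Bool} (hχ : IsTight χ) {a b : V}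
    (p : Path E a b) (hb : IsRegular E b) (h : χ (idem A p) = true) :
    ∃ (c : V) (e : E b c), χ (idem A (p.append (.cons e (.nil c)))) = true := by
  classical
  obtain ⟨⟨x⟩, hf⟩ := hb
  have := Fintype.ofFinite (Σ c, E b c)
  let F : Finset (Idem (Triples A)) :=
    Finset.univ.image fun x : Σ c, E b c => idem A (p.append (.cons x.2 (.nil x.1)))
  have mem (x : Σ c, E b c) : idem A (p.append (.cons x.2 (.nil x.1))) ∈ F :=
    Finset.mem_image_of_mem _ (Finset.mem_univ x)
  have hle : ∀ f ∈ F, f ≤ idem A p := by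
    intro f hf
    obtain ⟨x, -, rfl⟩ := Finset.mem_image.1 hf
    exact idem_append_le _ _
  have hcov : ∀ f : Idem (Triples A), f ≠ 0 → f ≤ idem A p → ∃ f' ∈ F, f * f' ≠ 0 := by
    intro f hf hfp
    rcases idem_cases f with rfl | ⟨a', b', q, rfl⟩
    · exact absurd rfl hf
    obtain ⟨rfl, r, rfl⟩ := exists_append_of_idem_le hfp
    cases r with
    | nil =>
      -- Here `f` is the idempotent of `p` itself, which meets every member of the family; that the
      -- family is nonempty is where regularity supplies an edge `x`.
      refine ⟨_, mem x, ?_⟩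
      simp only [Path.append_nil]
      rw [idem_mul_idem_append]
      exact idem_ne_zero _
    | @cons _ c _ e r =>
      -- A proper extension of `p` lies below the idempotent of `p` followed by its own next edge.
      refine ⟨_, mem ⟨c, e⟩, ?_⟩
      have h : p.append (.cons e r) = (p.append (.cons e (.nil c))).append r := by
        rw [Path.append_assoc]; rfl
      rw [h, mul_comm_idem, idem_mul_idem_append]
      exact idem_ne_zero _
  obtain ⟨f, hf, hχf⟩ := (hχ (idem A p) F hle hcov).1 h
  obtain ⟨⟨c, e⟩, -, rfl⟩ := Finset.mem_image.1 hf
  exact ⟨c, e, hχf⟩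

/-- At a regular vertex tightness lengthens the path by an edge and the section of `k` drops one
level; at level 0 or at a singular vertex `k` is already a unit and the empty path serves. -/
theorem exists_path_of_mem_tightLevel {χ : Idem (Triples A) → Bool} (hχ : IsTight χ) {n : ℕ}
    {a b : V} {k : b ⟶ b} (hk : k ∈ A.tightLevel n b) (p : Path E a b)
    (h : χ (idem A p) = true) :
    ∃ (c : V) (q : Path E b c), χ (idem A (p.append q)) = true ∧ A.pact k q = ⟨c, q, 𝟙 c⟩ := by
  induction n generalizing b with
  | zero =>
    obtain ⟨l, hl, h'⟩ := hk b (.nil b) le_rfl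
    simp only [pact_nil, Sigma.mk.injEq, heq_eq_eq, Prod.mk.injEq, true_and] at hl
    obtain rfl := hl.trans (h' (Or.inl rfl))
    exact ⟨b, .nil b, by simpa using h, rfl⟩
  | succ n ih =>
    by_cases hb : IsRegular E b
    · obtain ⟨c, e, he⟩ := exists_edge_of_isTight hχ p hb h
      obtain ⟨l, hl', hl⟩ := A.exists_act_of_mem_tightLevel_succ hk e
      obtain ⟨d, q, hq, hq'⟩ := ih hl' (p.append (.cons e (.nil c))) he
      refine ⟨d, .cons e q, ?_, A.pact_cons_of_act hl hq'⟩
      rwa [Path.append_assoc] at hq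
    · obtain ⟨l, hl, h'⟩ := hk b (.nil b) (Nat.zero_le _)
      simp only [pact_nil, Sigma.mk.injEq, heq_eq_eq, Prod.mk.injEq, true_and] at hl
      obtain rfl := hl.trans (h' (Or.inr hb))
      exact ⟨b, .nil b, by simpa using h, rfl⟩

/-- Two triples with the same nonzero image differ by some `k ∈ K_n` next to `q`; extending `q`
inside the support of `χ` to a path where `k` has trivial section removes the difference. -/
theorem toQuotient_tightKernel_reflectsGerms :
    IsSeparatingHom.ReflectsGerms (toQuotient A.tightKernel) := by
  intro χ s t hs h
  cases s with
  | zero =>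
    have h0 : Idem.dom (zero : Triples A) = 0 := Idem.ext rfl
    rw [h0, χ.2.1.map_zero] at hs
    cases hs
  | triple p g q =>
    cases t with
    | zero => cases h
    | triple p' g' q' =>
      simp only [toQuotient, triple.injEq] at h
      obtain ⟨h1, h2, h3, h4, hp, hg, hq⟩ := h
      cases h1
      cases h2
      cases h3
      cases h4
      obtain rfl := A.tightKernel.mapPath_injective (eq_of_heq hp)
      obtain rfl := A.tightKernel.mapPath_injective (eq_of_heq hq)
      obtain ⟨k, ⟨n, hk⟩, rfl⟩ := A.tightKernel.cls_eq_iff.1 (eq_of_heq hg)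
      rw [dom_triple] at hs
      obtain ⟨c, r, hr, hkr⟩ := exists_path_of_mem_tightLevel χ.2.2 hk q hs
      refine ⟨_, hr, ?_⟩
      rw [val_idem, triple_mul_triple_append, triple_mul_triple_append, A.pact_comp, hkr]
      simp

end Triples

/-! ### The isomorphisms and the contracting case -/

namespace SSAction

variable {V : Type u} [Groupoid.{v} V] {E : V → V → Type w} (A : SSAction E)

theorem topGroupoidIso_tightKernel :
    TopGroupoidIso A.TightGroupoid A.tightKernel.quotient.TightGroupoid :=
  (Triples.toQuotient_isSeparatingHom _).topGroupoidIso
    Triples.toQuotient_tightKernel_reflectsGerms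

theorem topGroupoidIso_kernel (h : ∀ a : V, A.tightKernel.carrier a = A.kernel.carrier a) :
    TopGroupoidIso A.TightGroupoid A.kernel.quotient.TightGroupoid := by
  rw [← Normal.ext_carrier h]
  exact A.topGroupoidIso_tightKernel

variable {A}

theorem IsContracting.isRegular (h : A.IsContracting) (a : V) : IsRegular E a :=
  have := h.finite_edges
  ⟨h.no_sources a, Finite.of_injective (fun x => (⟨a, x⟩ : Σ a c : V, E a c)) fun _ _ h => by simpa using h⟩

/-- For a contracting action in whose nucleus only units act trivially, the tight kernel is the
kernel. -/
theorem IsContracting.tightKernel_eq_kernel (h : A.IsContracting)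
    (hN : ∀ (a : V) (g : a ⟶ a), (⟨a, a, g⟩ : Σ a b : V, a ⟶ b) ∈ A.nucleus →
      g ∈ A.kernel.carrier a → g = 𝟙 a) (a : V) :
    A.tightKernel.carrier a = A.kernel.carrier a := by
  ext g
  constructor
  · rintro ⟨n, hg⟩ c p
    -- The level is raised to at least the length of `p`, so that its condition reaches `p`.
    obtain ⟨k, hk, -⟩ := A.tightLevel_mono (le_max_left n p.length) hg c p (le_max_right _ _)
    exact ⟨k, hk⟩
  · intro hg
    obtain ⟨n, hn⟩ := (A.nucleus_isLeast h).1.2 a a g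
    refine ⟨n, fun c p _ => ?_⟩
    obtain ⟨k, hk, hp⟩ := A.kernel.exists_pact p hg
    refine ⟨k, hp, fun h' => ?_⟩
    -- Every vertex is regular, so a unit is demanded only at length `n`, and there the section lies
    -- in both the nucleus and `N`.
    have h1 := hn c p (h'.resolve_right (not_not.2 (h.isRegular c))).ge
    rw [hp] at h1
    exact hN c k h1 hk

end SSAction

end SelfSim

theorem theoremC {V : Type u} [CategoryTheory.Groupoid.{v} V] {E : V → V → Type w}
    (A : SelfSim.SSAction E) :
    (A.IsContracting →
      (∀ (a : V) (g : a ⟶ a), (⟨a, a, g⟩ : Σ a b : V, a ⟶ b) ∈ A.nucleus →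
        g ∈ A.kernel.carrier a → g = 𝟙 a) →
      SelfSim.TopGroupoidIso A.TightGroupoid A.kernel.quotient.TightGroupoid) ∧
    SelfSim.TopGroupoidIso A.TightGroupoid A.tightKernel.quotient.TightGroupoid ∧
    ((∀ a : V, A.tightKernel.carrier a = A.kernel.carrier a) →
      SelfSim.TopGroupoidIso A.TightGroupoid A.kernel.quotient.TightGroupoid) := by
  exact ⟨fun h hN => A.topGroupoidIso_kernel (h.tightKernel_eq_kernel hN),
    A.topGroupoidIso_tightKernel, A.topGroupoidIso_kernel⟩
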